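/- **Setting.** Let $\mathbb F_p$ be the finite field with $p$ elements ($p$ a prime power), and let $R_1,R_2,z,k\ge 0$ be integers. Put $n=R_1+2z$, $N=R_2+2z$, $C=R_1+R_2+2z$, $\ell=knN$, with $n,N\ge 1$. Let $\mathbb F_q\supseteq\mathbb F_p$ and $\mathbb F_Q\supseteq\mathbb F_q$ be extensions of degrees $n$ and $N$ ($q=p^n$, $Q=q^N$) with fixed bases. Unfolding a matrix means replacing each entry by the row of its coordinates in the fixed basis; unfolding from $\mathbb F_Q$ to $\mathbb F_p$ goes through $\mathbb F_q$. Let $G_1\in\mathbb F_q^{n\times R_1}$ be a generator matrix of a Gabidulin code over $\mathbb F_q/\mathbb F_p$, that is $G_1=(g_i^{p^{j}})_{1\le i\le n,\,0\le j<R_1}A_1$ with $g_1,\dots,g_n$ linearly independent over $\mathbb F_p$ and $A_1$ invertible over $\mathbb F_q$, and let $G_2=(h_i^{q^{j}})_{1\le i\le N,\,0\le j<R_2}A_2\in\mathbb F_Q^{N\times R_2}$ likewise over $\mathbb F_Q/\mathbb F_q$. **Encoding.** The messages are $X_1\in\mathbb F_q^{R_1\times kN}$ and $X_2\in\mathbb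 F_Q^{R_2\times k}$. Let $M_1\in\mathbb F_p^{n\times\ell}$ and $M_2\in\mathbb F_p^{N\times\ell}$ be the unfoldings of $G_1X_1$ and $G_2X_2$ to $\mathbb F_p$. Source $1$ sends the rows of $[\,I_n\ \ O\ \ M_1\,]$ and source $2$ the rows of $[\,O\ \ I_N\ \ M_2\,]$. **Network.** The network is a finite directed acyclic multigraph with edge set $\mathcal E$, sources $s_1,s_2$ and a receiver $r$ which exactly $C$ edges enter. Its minimum cut capacities to $r$ are $C_1$ from $s_1$, $C_2$ from $s_2$ and $C$ from $\{s_1,s_2\}$, and $R_1\le C_1-2z$, $R_2\le C_2-2z$. Every edge carries a linear combination over $\mathbb F_p$ of the packets available at its tail (the packets on incoming edges and, at a source, the rows sent by that source), with independent uniformly random coefficients in $\mathbb F_p$. An adversary who knows everything, including the messages and the coefficients, chooses at most $z$ edges and adds an arbitrary packet from $\mathbb F_p^{n+N+\ell}$ to what each of them carries; this propagates downstream. The receiver sees only the matrix $Y\in\mathbb F_p^{C\times(n+N+\ell)}$ whose rows are the packets on its incoming edges. **Theorem.** There are absolute constants $A,d$ such that for all $\mathbb F_p,R_1,R_2,z,k$,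 bases and $G_1,G_2$ as above there is a decoder, depending on these data only and not on the network, the coefficients or the network transforms, with the following properties. 1. (Efficiency.) The decoder is a straight-line program over $\mathbb F_p$ with at most $A\,\ell\,C^{d}$ operations (constants, addition, subtraction, multiplication, inversion, selection by a test for zero). So its running time in operations over $\mathbb F_p$ is linear in the packet length $\ell$ and polynomial in $C\le|\mathcal E|$. 2. (Correctness.) For every network as above, with probability at least $1-2|\mathcal E|/p$ over the coding coefficients, the decoder outputs from $Y$ both $X_1$ and $X_2$ (as coordinates over $\mathbb F_p$), for all messages $X_1,X_2$ and all choices of the adversary. -/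

import Mathlib

universe u v w x y

/-! ### Networks, cuts and linear network coding -/

/-- A finite directed acyclic multigraph with node set `V` and edge set `E`. Every edge has unit
capacity; larger capacities are parallel edges. -/
structure Network (V : Type x) (E : Type y) where
  tail : E → V
  head : E → V
  acyclic : ∀ a : V, ¬ Relation.TransGen (fun a b => ∃ e, tail e = a ∧ head e = b) a a

namespace Network

variable {V : Type x} {E : Type y}

/-- The minimum cut capacity from the set of nodes `src` to the node `r`: the least number of edges
that leave a set of nodes which contains `src` and not `r`. -/
noncomputable def minCut (Net : Network V E) (src : Set V) (r : V) : ℕ :=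
  sInf {m : ℕ | ∃ S : Set V, src ⊆ S ∧ r ∉ S ∧
    m = {e : E | Net.tail e ∈ S ∧ Net.head e ∉ S}.ncard}

theorem wellFounded_precedes [Finite E] (Net : Network V E) :
    WellFounded (fun e' e : E => Net.head e' = Net.tail e) := by
  have key : ∀ e e' : E, Relation.TransGen (fun e' e : E => Net.head e' = Net.tail e) e e' →
      Relation.TransGen (fun a b => ∃ e, Net.tail e = a ∧ Net.head e = b)
        (Net.tail e) (Net.tail e') := by
    intro e e' he
    induction he with
    | single h => exact .single ⟨e, rfl, h⟩
    | tail _ h ih => exact ih.tail ⟨_, rfl, h⟩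
  have hirr : ∀ e : E, ¬ Relation.TransGen (fun e' e : E => Net.head e' = Net.tail e) e e :=
    fun e he => Net.acyclic (Net.tail e) (key e e he)
  have : Std.Irrefl (Relation.TransGen (fun e' e : E => Net.head e' = Net.tail e)) := ⟨hirr⟩
  exact (Finite.wellFounded_of_trans_of_irrefl
    (Relation.TransGen (fun e' e : E => Net.head e' = Net.tail e))).mono
    (fun _ _ h => Relation.TransGen.single h)

open Classical in
/-- The packets carried by the edges when the edge `e` carries the packet `b e` plus the linear
combination, with coefficients `a e' e`, of the packets on the edges `e'` that enter the tail
of `e`. -/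
noncomputable def flow {K : Type u} [Field K] [Fintype E] {γ : Type*} (Net : Network V E)
    (a : E → E → K) (b : E → γ → K) : E → γ → K :=
  Net.wellFounded_precedes.fix fun e packet =>
    b e + ∑ e' : E, if h : Net.head e' = Net.tail e then a e' e • packet e' h else 0

open Classical in
theorem flow_eq {K : Type u} [Field K] [Fintype E] {γ : Type*} (Net : Network V E)
    (a : E → E → K) (b : E → γ → K) (e : E) :
    Net.flow a b e =
      b e + ∑ e' : E, if Net.head e' = Net.tail e then a e' e • Net.flow a b e' else 0 := by
  unfold flow
  rw [WellFounded.fix_eq]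
  rfl

/-- The local coding coefficients of a linear network code in which the sources have `n` and `N`
packets to send. The coefficients with which an edge `e` combines the packets of the edges and
the packets of the two sources are `c (.inl e') e`, `c (.inr (.inl i)) e` and
`c (.inr (.inr i)) e`. Coefficients of packets that are not present at the tail of `e` are never
used. -/
abbrev Coeffs (K : Type u) (E : Type y) (n N : ℕ) : Type (max u y) :=
  (E ⊕ (Fin n ⊕ Fin N)) → E → K

open Classical in
/-- The packet on every edge: the combination of the packets available at the tail of the edge
(packets on the incoming edges; rows of `m₁` at `s₁`; rows of `m₂` at `s₂`), plus the packet `inj e`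
which the adversary injects into the edge. -/
noncomputable def packets {K : Type u} [Field K] [Fintype E] {γ : Type*} {n N : ℕ}
    (Net : Network V E) (s₁ s₂ : V) (c : Coeffs K E n N) (m₁ : Matrix (Fin n) γ K)
    (m₂ : Matrix (Fin N) γ K) (inj : E → γ → K) : E → γ → K :=
  Net.flow (fun e' e => c (.inl e') e) fun e =>
    (if Net.tail e = s₁ then ∑ i, c (.inr (.inl i)) e • m₁ i else 0) +
    (if Net.tail e = s₂ then ∑ i, c (.inr (.inr i)) e • m₂ i else 0) + inj e

/-- The matrix whose rows are the packets on the edges that enter the receiver `r`, these edges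
being listed by `recv`. -/
noncomputable def received {K : Type u} [Field K] [Fintype E] {γ : Type*} {n N C : ℕ}
    (Net : Network V E) (s₁ s₂ : V) {r : V} (recv : Fin C ≃ {e : E // Net.head e = r})
    (c : Coeffs K E n N) (m₁ : Matrix (Fin n) γ K) (m₂ : Matrix (Fin N) γ K)
    (inj : E → γ → K) : Matrix (Fin C) γ K :=
  Matrix.of fun i => Net.packets s₁ s₂ c m₁ m₂ inj (recv i)

end Network

/-- The probability of the event `A` under the uniform distribution on a finite type. -/
noncomputable def uniformProb {Ω : Type*} (A : Set Ω) : ℝ :=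
  (A.ncard : ℝ) / (Nat.card Ω : ℝ)

/-! ### Unfolding, Gabidulin codes and the transmitted matrices -/

/-- Unfolding: every entry is replaced by the row of its coordinates in the basis `b`. -/
noncomputable def unfoldMat {K : Type u} {F : Type v} [Field K] [Field F] [Algebra K F]
    {ι m κ : Type*} (b : Module.Basis ι K F) (A : Matrix m κ F) : Matrix m (κ × ι) K :=
  Matrix.of fun i j => b.repr (A i j.1) j.2

/-- `G` is a generator matrix of a Gabidulin code of length `m` and dimension `R` over the extension
`F` of the finite field `K`: its columns are a basis of the code which the columns of the matrix
`(gᵢ ^ (|K| ^ j))` generate, for some `g₁, …, gₘ` in `F` that are linearly independent over `K`. -/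
def IsGabidulinGenerator (K : Type u) {F : Type v} [Field K] [Field F] [Algebra K F] {m R : ℕ}
    (G : Matrix (Fin m) (Fin R) F) : Prop :=
  ∃ (g : Fin m → F) (A : Matrix (Fin R) (Fin R) F), LinearIndependent K g ∧ IsUnit A ∧
    G = (Matrix.of fun (i : Fin m) (j : Fin R) => g i ^ (Nat.card K ^ (j : ℕ))) * A

/-- The column indices of a packet: headers of length `n` and `N`, then `k * N * n` symbols. -/
abbrev PacketIdx (n N k : ℕ) : Type := Fin n ⊕ (Fin N ⊕ ((Fin k × Fin N) × Fin n))

/-- The matrix `[I O M₁]` sent by the first source, `M₁` being the unfolding of `G₁ X₁`. -/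
noncomputable def sent₁ {K : Type u} {F : Type v} [Field K] [Field F] [Algebra K F] {n N k R : ℕ}
    (b₁ : Module.Basis (Fin n) K F) (G₁ : Matrix (Fin n) (Fin R) F)
    (X₁ : Matrix (Fin R) (Fin k × Fin N) F) : Matrix (Fin n) (PacketIdx n N k) K :=
  Matrix.fromCols 1 (Matrix.fromCols 0 (unfoldMat b₁ (G₁ * X₁)))

/-- The matrix `[O I M₂]` sent by the second source, `M₂` being the unfolding of `G₂ X₂` from the
double extension `L` to `F` and then to `K`. -/
noncomputable def sent₂ {K : Type u} {F : Type v} {L : Type w} [Field K] [Field F] [Algebra K F]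
    [Field L] [Algebra F L] {n N k R : ℕ}
    (b₁ : Module.Basis (Fin n) K F) (b₂ : Module.Basis (Fin N) F L)
    (G₂ : Matrix (Fin N) (Fin R) L) (X₂ : Matrix (Fin R) (Fin k) L) :
    Matrix (Fin N) (PacketIdx n N k) K :=
  Matrix.fromCols 0 (Matrix.fromCols 1 (unfoldMat b₁ (unfoldMat b₂ (G₂ * X₂))))

/-! ### Arithmetic programs -/

/-- One operation over the field `K`; the first register of each instruction is its target. The
instruction `sel t i j l` is a zero test: `t` receives register `j` if register `i` holds `0`,
and register `l` otherwise. -/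
inductive ArithInstr (K : Type u) (ρ : Type) where
  | const (t : ρ) (a : K)
  | add (t i j : ρ)
  | sub (t i j : ρ)
  | mul (t i j : ρ)
  | inv (t i : ρ)
  | sel (t i j l : ρ)

namespace ArithInstr

variable {K : Type u} {ρ : Type}

open Classical in
/-- The effect of one instruction on the contents of the registers. -/
noncomputable def step [Field K] (s : ρ → K) : ArithInstr K ρ → ρ → K
  | const t a => Function.update s t a
  | add t i j => Function.update s t (s i + s j)
  | sub t i j => Function.update s t (s i - s j)
  | mul t i j => Function.update s t (s i * s j)
  | inv t i => Function.update s t (s i)⁻¹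
  | sel t i j l => Function.update s t (if s i = 0 then s j else s l)

end ArithInstr

/-- A straight-line program over `K` with inputs indexed by `ι` and outputs indexed by `κ`. Its
registers are the input registers `.inl i` and the working registers `.inr n`. -/
structure ArithProgram (K : Type u) (ι κ : Type) where
  code : List (ArithInstr K (ι ⊕ ℕ))
  out : κ → ι ⊕ ℕ

namespace ArithProgram

variable {K : Type u} {ι κ : Type}

/-- The number of operations over `K` that the program executes. -/
def cost (P : ArithProgram K ι κ) : ℕ := P.code.length

/-- The result of running the program on the input `a`; working registers start at `0`. -/
noncomputable def eval [Field K] (P : ArithProgram K ι κ) (a : ι → K) : κ → K :=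
  fun o => P.code.foldl ArithInstr.step (Sum.elim a fun _ => 0) (P.out o)

end ArithProgram

/-! ### Rank of the received packets under random linear network coding -/

namespace Network

open Module Submodule

section Cut

variable {V : Type x} {E : Type y} {ι : Type*}

/-! Write `K`, `F`, `L` for the fields with p, q, Q elements. The network is a linear channel: the
received matrix is `T₁ * sent₁ + T₂ * sent₂ + T₃ * inj`, where the transfer matrices depend on the
coefficients only and at most `z` columns of `T₃` matter. The receiver knows the corrupted headers
`Y₁ = T₁ + T₃ Z₁` and `Y₂ = T₂ + T₃ Z₂` instead of `T₁` and `T₂`. Replacing `T` by `Y` only changes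
the unknown error vectors (`sum_smul_eq_of_headers`), so each payload position, folded to a symbol
of `L`, reads `y = Y₁ G₁ m₁ + Y₂ G₂ m₂ + T₃ ζ` with `z` unknown `ζ`.

The second source is decoded over `L / F` with linearized polynomials. Some monic `V` of q-degree
`z` kills all `ζ`. As `V` is `F`-linear, `V y = Y₁ G₁ u + Y₂ f(h)`, where `u = V m₁` and `f`, the
composite of `V` with the message polynomial, has q-degree below `R₂ + z`. This system is linear
over `K` in the coefficients of `V`, in `u` and in `f`. If the rows of `[T₁ G₁ | T₂]` span `F ^ (R₁
+ N)`, where `R₁ + N = C`, then any solution has `f` equal to its own `V` composed with the message: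
the difference is a linearized polynomial of rank at most `z` with too few coefficients to be
nonzero (`key_equation_unique`). Dividing by `V` is a second linear system (`exists_decoder`).
Subtracting `Y₂ G₂ m₂` and taking coordinates over `F` leaves single-source problems over `F / K`,
which the same decoder solves if the rows of `T₁` span `K ^ n` (`exists_two_stage_decoder`).

Each spanning condition fails for at most a fraction `|E| / |K|` of the coefficients. The edges are
processed in topological order while every cut retains enough dimension outside it plus unused edges
across it; submodularity shows that one edge can spoil this only if its packet falls in one proper
subspace (`Feasible.exists_subspace`, `ncard_rank_lt_mul_card_le`). The conditions do not involve
messages or errors, so one good choice of coefficients serves all of them.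

For the cost, every payload position is decoded by itself with the shared headers, by systems of
size polynomial in `C`, solved by branch-free elimination (`exists_solve`). -/

/-- The node at which a packet is present: the head of the edge which carries it, or its source. -/
def loc (Net : Network V E) (src : ι → V) : E ⊕ ι → V := Sum.elim Net.head src

/-- The edges outside `D` that leave `S`. -/
def cutOff (Net : Network V E) (D : Set E) (S : Set V) : Set E :=
  {e | e ∉ D ∧ Net.tail e ∈ S ∧ Net.head e ∉ S}

theorem ncard_cutOff_submodular [Finite E] (Net : Network V E) (D : Set E) (S T : Set V) :
    (Net.cutOff D (S ∩ T)).ncard + (Net.cutOff D (S ∪ T)).ncard ≤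
      (Net.cutOff D S).ncard + (Net.cutOff D T).ncard := by
  rw [← Set.ncard_union_add_ncard_inter (Net.cutOff D (S ∩ T)),
    ← Set.ncard_union_add_ncard_inter (Net.cutOff D S)]
  refine Nat.add_le_add (Set.ncard_le_ncard ?_) (Set.ncard_le_ncard ?_)
  · rintro e (⟨h1, h2, h3⟩ | ⟨h1, h2, h3⟩) <;>
      simp only [cutOff, Set.mem_inter_iff, Set.mem_union, Set.mem_ofPred_eq] at * <;> tauto
  · rintro e ⟨⟨h1, h2, h3⟩, ⟨h4, h5, h6⟩⟩
    simp only [cutOff, Set.mem_inter_iff, Set.mem_union, Set.mem_ofPred_eq] at *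
    tauto

variable {F : Type*} [Field F] {U : Type*} [AddCommGroup U] [Module F U]

/-- The span of the source packets and of the packets on the edges of `D` that are present outside
the set of nodes `S`. -/
def outSpan (F : Type*) [Field F] {U : Type*} [AddCommGroup U] [Module F U] (Net : Network V E)
    (src : ι → V) (vec : E ⊕ ι → U) (D : Set E) (S : Set V) : Submodule F U :=
  span F (vec '' {a | (∀ e, a = .inl e → e ∈ D) ∧ Net.loc src a ∉ S})

/-- Every cut between the nodes and `r` has value at least `m` when the edges of `D` have already
delivered their packets. -/
def Feasible (F : Type*) [Field F] {U : Type*} [AddCommGroup U] [Module F U] (Net : Network V E)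
    (src : ι → V) (r : V) (m : ℕ) (vec : E ⊕ ι → U) (D : Set E) : Prop :=
  ∀ S : Set V, r ∉ S → m ≤ finrank F (Net.outSpan F src vec D S) + (Net.cutOff D S).ncard

theorem outSpan_congr (Net : Network V E) (src : ι → V) {vec vec' : E ⊕ ι → U} {D : Set E}
    (h : ∀ a, (∀ e, a = .inl e → e ∈ D) → vec a = vec' a) (S : Set V) :
    Net.outSpan F src vec D S = Net.outSpan F src vec' D S := by
  unfold outSpan
  congr 1
  exact Set.image_congr fun a ha => h a ha.1

theorem Feasible.congr {Net : Network V E} {src : ι → V} {r : V} {m : ℕ} {vec vec' : E ⊕ ι → U}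
    {D : Set E} (h : ∀ a, (∀ e, a = .inl e → e ∈ D) → vec a = vec' a)
    (hf : Net.Feasible F src r m vec D) : Net.Feasible F src r m vec' D := by
  intro S hS
  rw [← outSpan_congr Net src h]
  exact hf S hS

/-- What is outside an intersection is outside one of the two sets. The exact equality for
intersections, against a mere inclusion for unions, lets the dimension formula play the role of
submodularity. -/
theorem outSpan_inter (Net : Network V E) (src : ι → V) (vec : E ⊕ ι → U) (D : Set E)
    (S T : Set V) :
    Net.outSpan F src vec D (S ∩ T) = Net.outSpan F src vec D S ⊔ Net.outSpan F src vec D T := by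
  unfold outSpan
  rw [← span_union, ← Set.image_union]
  congr 2
  ext a
  simp only [Set.mem_inter_iff, Set.mem_ofPred_eq, Set.mem_union]
  tauto

theorem outSpan_anti (Net : Network V E) (src : ι → V) (vec : E ⊕ ι → U) (D : Set E)
    {S T : Set V} (h : S ⊆ T) : Net.outSpan F src vec D T ≤ Net.outSpan F src vec D S :=
  span_mono (Set.image_mono fun _ ha => ⟨ha.1, fun hS => ha.2 (h hS)⟩)

theorem outSpan_insert_le (Net : Network V E) (src : ι → V) (vec : E ⊕ ι → U) (D : Set E)
    (e : E) (S : Set V) :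
    Net.outSpan F src vec D S ≤ Net.outSpan F src vec (insert e D) S :=
  span_mono (Set.image_mono fun _ ha => ⟨fun e h => Or.inr (ha.1 e h), ha.2⟩)

/-- When the next edge `e` is processed, feasibility persists unless the packet on `e` lies in a
certain subspace `W` that does not contain all packets available at the tail of `e`. -/
theorem Feasible.exists_subspace [Finite E] [FiniteDimensional F U] {Net : Network V E}
    {src : ι → V} {r : V} {m : ℕ} {vec : E ⊕ ι → U} {D : Set E}
    (hf : Net.Feasible F src r m vec D) {e : E} (he : e ∉ D)
    (hpre : ∀ e', Net.head e' = Net.tail e → e' ∈ D) :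
    (∀ vec' : E ⊕ ι → U, (∀ a, (∀ e, a = .inl e → e ∈ D) → vec a = vec' a) →
        Net.Feasible F src r m vec' (insert e D)) ∨
    ∃ W : Submodule F U,
      (∃ a, Net.loc src a = Net.tail e ∧ vec a ∉ W) ∧
      ∀ vec' : E ⊕ ι → U, (∀ a, (∀ e, a = .inl e → e ∈ D) → vec a = vec' a) →
        vec' (.inl e) ∉ W → Net.Feasible F src r m vec' (insert e D) := by
  classical
  let f : Set V → ℕ := fun S =>
    finrank F (Net.outSpan F src vec D S) + (Net.cutOff D S).ncard
  -- The tight cuts crossed by `e`; only these can be violated when `e` is moved into `D`.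
  let T : Set (Set V) := {S | r ∉ S ∧ Net.tail e ∈ S ∧ Net.head e ∉ S ∧ f S = m}
  -- feasibility at a cut which is not tight
  have hslack : ∀ vec' : E ⊕ ι → U, (∀ a, (∀ e, a = .inl e → e ∈ D) → vec a = vec' a) →
      ∀ S, r ∉ S → S ∉ T →
        m ≤ finrank F (Net.outSpan F src vec' (insert e D) S) +
          (Net.cutOff (insert e D) S).ncard := by
    intro vec' hv S hr hT
    have h1 : finrank F (Net.outSpan F src vec D S) ≤
        finrank F (Net.outSpan F src vec' (insert e D) S) := by
      rw [outSpan_congr Net src hv]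
      exact finrank_mono (outSpan_insert_le ..)
    by_cases hc : Net.tail e ∈ S ∧ Net.head e ∉ S
    · have h2 : m < f S := lt_of_le_of_ne (hf S hr) fun h => hT ⟨hr, hc.1, hc.2, h.symm⟩
      have h3 : (Net.cutOff D S).ncard ≤ (Net.cutOff (insert e D) S).ncard + 1 := by
        refine (Set.ncard_le_ncard (t := insert e (Net.cutOff (insert e D) S)) ?_).trans
          (Set.ncard_insert_le _ _)
        rintro a ⟨ha, ha'⟩
        by_cases hae : a = e
        · exact Or.inl hae
        · exact Or.inr ⟨by simp [hae, ha], ha'⟩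
      simp only [f] at h2
      omega
    · have h3 : (Net.cutOff D S).ncard ≤ (Net.cutOff (insert e D) S).ncard := by
        refine Set.ncard_le_ncard ?_
        rintro a ⟨ha, ha'⟩
        refine ⟨?_, ha'⟩
        rintro (rfl | h)
        exacts [hc ha', ha h]
      exact (hf S hr).trans (Nat.add_le_add h1 h3)
  by_cases hTe : T = ∅
  · left
    intro vec' hv S hr
    exact hslack vec' hv S hr (by simp [hTe])
  right
  -- a tight cut for which the outer span is largest
  obtain ⟨S₀, hS₀, hmax⟩ : ∃ S₀ ∈ T, ∀ S ∈ T,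
      Net.outSpan F src vec D S ≤ Net.outSpan F src vec D S₀ := by
    have hbdd : ∃ S₀ ∈ T, ∀ S ∈ T, finrank F (Net.outSpan F src vec D S) ≤
        finrank F (Net.outSpan F src vec D S₀) := by
      obtain ⟨S₁, h₁⟩ := Set.nonempty_iff_ne_empty.mpr hTe
      let I : Set ℕ := (fun S => finrank F (Net.outSpan F src vec D S)) '' T
      have hI : BddAbove I := ⟨finrank F U, by
        rintro _ ⟨S, -, rfl⟩
        exact finrank_le _⟩
      obtain ⟨S₀, h₀, h₀'⟩ := Nat.sSup_mem (s := I) ⟨_, S₁, h₁, rfl⟩ hI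
      refine ⟨S₀, h₀, fun S hS => ?_⟩
      exact (le_csSup hI ⟨S, hS, rfl⟩).trans_eq h₀'.symm
    obtain ⟨S₀, h₀, hm⟩ := hbdd
    refine ⟨S₀, h₀, fun S hS => ?_⟩
    -- Both `S ∩ S₀` and `S ∪ S₀` have value at least `m`, while submodularity bounds the sum of the
    -- values by `2 * m`. Hence `S ∩ S₀` is tight, its outer span is the sum of the two, and
    -- maximality of `S₀` absorbs that of `S`.
    have hsub := Net.ncard_cutOff_submodular D S S₀
    have hdim := finrank_sup_add_finrank_inf_eq (Net.outSpan F src vec D S)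
      (Net.outSpan F src vec D S₀)
    have hinf : finrank F (Net.outSpan F src vec D (S ∪ S₀)) ≤
        finrank F ↥(Net.outSpan F src vec D S ⊓ Net.outSpan F src vec D S₀) :=
      finrank_mono (le_inf (outSpan_anti _ _ _ _ Set.subset_union_left)
        (outSpan_anti _ _ _ _ Set.subset_union_right))
    have hu := hf (S ∪ S₀) (by rintro (h | h); exacts [hS.1 h, h₀.1 h])
    have hi := hf (S ∩ S₀) (fun h => hS.1 h.1)
    have e1 := hS.2.2.2
    have e2 := h₀.2.2.2
    simp only [f] at e1 e2
    rw [outSpan_inter] at hi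
    have hint : S ∩ S₀ ∈ T := by
      refine ⟨fun h => hS.1 h.1, ⟨hS.2.1, h₀.2.1⟩, fun h => hS.2.2.1 h.1, ?_⟩
      simp only [f]
      rw [outSpan_inter]
      omega
    have h5 := hm _ hint
    rw [outSpan_inter] at h5
    have h6 := eq_of_le_of_finrank_le
      (le_sup_right (a := Net.outSpan F src vec D S) (b := Net.outSpan F src vec D S₀)) h5
    rw [h6]
    exact le_sup_left
  refine ⟨Net.outSpan F src vec D S₀, ?_, ?_⟩
  -- If the span outside `S₀` contained every packet at the tail of `e`, removing the tail from `S₀`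
  -- would keep the span and lose the cut edge `e`. No new cut edge appears, since the edges into
  -- the tail are already in `D`; the resulting value is below `m`.
  · by_contra! hall
    have h1 := hf (S₀ \ {Net.tail e}) (fun h => hS₀.1 h.1)
    have h2 : Net.outSpan F src vec D (S₀ \ {Net.tail e}) ≤ Net.outSpan F src vec D S₀ := by
      refine span_le.mpr ?_
      rintro _ ⟨a, ⟨ha, ha'⟩, rfl⟩
      by_cases hae : Net.loc src a = Net.tail e
      · exact hall a hae
      · exact subset_span ⟨a, ⟨ha, fun h => ha' ⟨h, hae⟩⟩, rfl⟩
    have h3 : (Net.cutOff D (S₀ \ {Net.tail e})).ncard + 1 ≤ (Net.cutOff D S₀).ncard := by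
      rw [← Set.ncard_insert_of_notMem (a := e) (fun h => h.2.1.2 rfl)]
      refine Set.ncard_le_ncard ?_
      rintro a (rfl | ⟨ha, hat, hah⟩)
      · exact ⟨he, hS₀.2.1, hS₀.2.2.1⟩
      · refine ⟨ha, hat.1, fun h => ?_⟩
        by_cases hh : Net.head a = Net.tail e
        · exact ha (hpre a hh)
        · exact hah ⟨h, hh⟩
    have h4 := finrank_mono h2
    have h5 := hS₀.2.2.2
    simp only [f] at h5
    omega
  · intro vec' hv hW S hr
    by_cases hS : S ∈ T
    -- A tight cut loses the edge `e` but gains a dimension, because its outer span lies in the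
    -- maximal one, which avoids the new packet.
    · have h1 : (Net.cutOff D S).ncard ≤ (Net.cutOff (insert e D) S).ncard + 1 := by
        refine (Set.ncard_le_ncard (t := insert e (Net.cutOff (insert e D) S)) ?_).trans
          (Set.ncard_insert_le _ _)
        rintro a ⟨ha, ha'⟩
        by_cases hae : a = e
        · exact Or.inl hae
        · exact Or.inr ⟨by simp [hae, ha], ha'⟩
      have h2 : Net.outSpan F src vec D S < Net.outSpan F src vec' (insert e D) S := by
        rw [outSpan_congr Net src hv]
        refine lt_of_le_of_ne (outSpan_insert_le ..) fun h => hW ?_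
        refine hmax S hS ?_
        rw [outSpan_congr Net src hv, h]
        refine subset_span ⟨.inl e, ⟨?_, hS.2.2.1⟩, rfl⟩
        rintro e' h
        cases h
        exact Or.inl rfl
      have h3 := finrank_lt_finrank_of_lt h2
      have h4 := hS.2.2.2
      simp only [f] at h4
      omega
    · exact hslack vec' hv S hr hS

end Cut

section Probability

variable {V : Type x} {E : Type y} {ι : Type*} {K : Type*} [Field K]
  {F : Type*} [Field F] [Algebra K F] {U : Type*} [AddCommGroup U] [Module F U] [Module K U]
  [IsScalarTower K F U]

/-- An edge outside `D` all of whose predecessors are in `D`. -/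
theorem exists_next_edge [Finite E] (Net : Network V E) {D : Set E} (hD : D ≠ Set.univ) :
    ∃ e, e ∉ D ∧ ∀ e', Net.head e' = Net.tail e → e' ∈ D := by
  obtain ⟨e₁, h₁⟩ := (Set.ne_univ_iff_exists_notMem D).mp hD
  obtain ⟨e, he, hmin⟩ := Net.wellFounded_precedes.has_min Dᶜ ⟨e₁, h₁⟩
  exact ⟨e, he, fun e' h => by_contra fun hn => hmin e' hn h⟩

open Classical in
/-- Random linear network coding: if every cut between the nodes and `r` has value at least `m`,
then the packets present at `r` have rank less than `m` for at most a fraction `|E| / |K|` of the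
coefficients. -/
theorem ncard_rank_lt_mul_card_le [Finite K] [Fintype E] [Fintype ι] [FiniteDimensional F U]
    (Net : Network V E) (src : ι → V) (r : V) (m : ℕ)
    (vec : (E ⊕ ι → E → K) → E ⊕ ι → U) (u : ι → U)
    (hsrc : ∀ c i, vec c (.inr i) = u i)
    (hedge : ∀ c e, vec c (.inl e) =
      ∑ a, if Net.loc src a = Net.tail e then c a e • vec c a else 0)
    (hcut : ∀ S : Set V, r ∉ S →
      m ≤ finrank F (span F (u '' {i | src i ∉ S})) +
        {e | Net.tail e ∈ S ∧ Net.head e ∉ S}.ncard) :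
    {c | ¬ m ≤ finrank F (span F (vec c '' {a | Net.loc src a = r}))}.ncard * Nat.card K ≤
      Fintype.card E * Nat.card (E ⊕ ι → E → K) := by
  -- packets on a closed set of edges depend only on the coefficients of these edges
  have hdep : ∀ (D : Set E), (∀ e ∈ D, ∀ e', Net.head e' = Net.tail e → e' ∈ D) →
      ∀ c c' : E ⊕ ι → E → K, (∀ a, ∀ e ∈ D, c a e = c' a e) →
      ∀ a, (∀ e, a = .inl e → e ∈ D) → vec c a = vec c' a := by
    intro D hD c c' hcc a ha
    rcases a with e | i
    · have he := ha e rfl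
      clear ha
      induction e using Net.wellFounded_precedes.induction with
      | _ e ih =>
        rw [hedge, hedge]
        refine Finset.sum_congr rfl fun a _ => ?_
        split_ifs with h
        · rw [hcc a e he]
          rcases a with e' | i
          · rw [ih e' h (hD e he e' h)]
          · rw [hsrc, hsrc]
        · rfl
    · rw [hsrc, hsrc]
  -- Union bound along a topological order: each processed edge adds a fraction of at most `1 / |K|`
  -- to the bad coefficients.
  have hstep : ∀ k ≤ Fintype.card E, ∃ D : Set E, D.ncard = k ∧
      (∀ e ∈ D, ∀ e', Net.head e' = Net.tail e → e' ∈ D) ∧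
      {c | ¬ Net.Feasible F src r m (vec c) D}.ncard * Nat.card K ≤
        k * Nat.card (E ⊕ ι → E → K) := by
    intro k
    induction k with
    | zero =>
      intro _
      refine ⟨∅, by simp, by simp, ?_⟩
      have : {c | ¬ Net.Feasible F src r m (vec c) (∅ : Set E)} = ∅ := by
        ext c
        simp only [Set.mem_ofPred_eq, Set.mem_empty_iff_false, iff_false, not_not]
        intro S hr
        have h1 := hcut S hr
        have h2 : Net.cutOff ∅ S = {e | Net.tail e ∈ S ∧ Net.head e ∉ S} := by
          ext; simp [cutOff]
        have h3 : Net.outSpan F src (vec c) ∅ S = span F (u '' {i | src i ∉ S}) := by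
          unfold outSpan
          congr 1
          ext w
          constructor
          · rintro ⟨e | i, ⟨h, h'⟩, rfl⟩
            · exact absurd (h e rfl) (by simp)
            · exact ⟨i, h', (hsrc c i).symm⟩
          · rintro ⟨i, h, rfl⟩
            exact ⟨.inr i, ⟨by simp, h⟩, hsrc c i⟩
        rw [h2, h3]
        exact h1
      simp [this]
    | succ k ih =>
      intro hk
      obtain ⟨D, hDk, hD, hbad⟩ := ih (by omega)
      have hDu : D ≠ Set.univ := by
        rintro rfl
        rw [Set.ncard_univ, Nat.card_eq_fintype_card] at hDk
        omega
      obtain ⟨e, he, hpre⟩ := Net.exists_next_edge hDu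
      refine ⟨insert e D, by rw [Set.ncard_insert_of_notMem he, hDk], ?_, ?_⟩
      · rintro e₁ (rfl | h) e₂ h₂
        · exact Or.inr (hpre e₂ h₂)
        · exact Or.inr (hD e₁ h e₂ h₂)
      -- Forgetting the coefficients of `e` leaves all packets processed so far unchanged, so the
      -- subspace `W` and the packet `a` below can be chosen from `z c` alone.
      let z : (E ⊕ ι → E → K) → (E ⊕ ι → E → K) := fun c a e' => if e' = e then 0 else c a e'
      have hz : ∀ c a, (∀ e, a = .inl e → e ∈ D) → vec (z c) a = vec c a := by
        intro c
        refine hdep D hD _ _ fun a e' he' => ?_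
        have : e' ≠ e := fun h => he (h ▸ he')
        simp [z, this]
      let B : Set (E ⊕ ι → E → K) := {c | Net.Feasible F src r m (vec c) D ∧
        ¬ Net.Feasible F src r m (vec c) (insert e D)}
      have hB : B.ncard * Nat.card K ≤ Nat.card (E ⊕ ι → E → K) := by
        have hW : ∀ c₀ : E ⊕ ι → E → K, ∃ (W : Submodule F U) (a : E ⊕ ι),
            (∃ c ∈ B, z c = c₀) → Net.loc src a = Net.tail e ∧ vec c₀ a ∉ W ∧
              ∀ c ∈ B, z c = c₀ → vec c (.inl e) ∈ W := by
          intro c₀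
          by_cases hex : ∃ c ∈ B, z c = c₀
          · obtain ⟨c, hc, rfl⟩ := hex
            have hf : Net.Feasible F src r m (vec (z c)) D :=
              hc.1.congr fun a ha => (hz c a ha).symm
            rcases hf.exists_subspace he hpre with h | ⟨W, ⟨a, ha, ha'⟩, h⟩
            · exact absurd (h (vec c) (hz c)) hc.2
            · refine ⟨W, a, fun _ => ⟨ha, ha', fun c' hc' hcc => ?_⟩⟩
              by_contra hn
              refine hc'.2 (h (vec c') (fun a ha => ?_) hn)
              rw [← hcc]
              exact hz c' a ha
          · exact ⟨⊤, .inl e, fun h => absurd h hex⟩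
        choose W a hWa using hW
        -- Overwriting the coefficient of the chosen packet at `e` by an arbitrary scalar is
        -- injective on `B × K`. The image determines `z c`, hence `a` and the scalar; the
        -- overwritten value is recovered because two bad values would put a nonzero multiple of the
        -- packet `a` into `W`.
        let Φ : B × K → (E ⊕ ι → E → K) := fun p b e' =>
          if e' = e ∧ b = a (z p.1) then p.2 else p.1.1 b e'
        have hzΦ : ∀ p, z (Φ p) = z p.1 := by
          intro p
          funext b e'
          by_cases h : e' = e <;> simp [z, Φ, h]
        have hinj : Function.Injective Φ := by
          rintro ⟨⟨c, hc⟩, t⟩ ⟨⟨c', hc'⟩, t'⟩ h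
          have hzz : z c = z c' := by
            have h1 := hzΦ (⟨c, hc⟩, t)
            have h2 := hzΦ (⟨c', hc'⟩, t')
            rw [h] at h1
            exact h1.symm.trans h2
          obtain ⟨hloc, hnot, hin⟩ := hWa (z c) ⟨c, hc, rfl⟩
          have ht : t = t' := by
            have := congrFun (congrFun h (a (z c))) e
            simpa [Φ, hzz] using this
          have hoff : ∀ b e', ¬ (e' = e ∧ b = a (z c)) → c b e' = c' b e' := by
            intro b e' hbe
            have := congrFun (congrFun h b) e'
            simp only [Φ, ← hzz] at this
            rwa [if_neg hbe, if_neg hbe] at this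
          have hvz : ∀ b, Net.loc src b = Net.tail e → ∀ d, vec (z d) b = vec d b := by
            intro b hb d
            refine hz d b fun e' h' => ?_
            subst h'
            exact hpre e' hb
          have hdiff : vec c (.inl e) - vec c' (.inl e) =
              (c (a (z c)) e - c' (a (z c)) e) • vec (z c) (a (z c)) := by
            rw [hedge, hedge, ← Finset.sum_sub_distrib,
              Finset.sum_eq_single (a (z c))]
            · rw [if_pos hloc, if_pos hloc, sub_smul, ← hvz _ hloc c, ← hvz _ hloc c', hzz]
            · intro b _ hb
              split_ifs with hbl
              · rw [hoff b e (fun h => hb h.2), ← hvz b hbl c, ← hvz b hbl c', hzz, sub_self]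
              · simp
            · simp
          have hmem : (c (a (z c)) e - c' (a (z c)) e) • vec (z c) (a (z c)) ∈ W (z c) := by
            rw [← hdiff]
            exact sub_mem (hin c hc rfl) (hin c' hc' hzz.symm)
          have hcoef : c (a (z c)) e = c' (a (z c)) e := by
            by_contra hne
            refine hnot ?_
            rw [← algebraMap_smul F] at hmem
            exact ((W (z c)).smul_mem_iff (by simpa [sub_eq_zero] using hne)).mp hmem
          have hcc : c = c' := by
            funext b e'
            by_cases hbe : e' = e ∧ b = a (z c)
            · rw [hbe.1, hbe.2, hcoef]
            · exact hoff b e' hbe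
          subst hcc
          rw [ht]
        have := Nat.card_le_card_of_injective Φ hinj
        rwa [Nat.card_prod, Nat.card_coe_set_eq] at this
      have hsub : {c | ¬ Net.Feasible F src r m (vec c) (insert e D)} ⊆
          {c | ¬ Net.Feasible F src r m (vec c) D} ∪ B := by
        intro c hc
        by_cases h : Net.Feasible F src r m (vec c) D
        · exact Or.inr ⟨h, hc⟩
        · exact Or.inl h
      calc _ ≤ ({c | ¬ Net.Feasible F src r m (vec c) D}.ncard + B.ncard) * Nat.card K :=
            Nat.mul_le_mul_right _ ((Set.ncard_le_ncard hsub).trans (Set.ncard_union_le _ _))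
        _ ≤ k * Nat.card (E ⊕ ι → E → K) + Nat.card (E ⊕ ι → E → K) := by
            rw [add_mul]
            exact Nat.add_le_add hbad hB
        _ = _ := by ring
  obtain ⟨D, hDk, -, hbad⟩ := hstep _ le_rfl
  have hDu : D = Set.univ := by
    rw [Set.eq_univ_iff_ncard, hDk, Nat.card_eq_fintype_card]
  subst hDu
  refine le_trans (Nat.mul_le_mul_right _ (Set.ncard_le_ncard ?_)) hbad
  intro c hc hf
  refine hc ?_
  -- With all edges processed, the cut around `r` has no edges left, so feasibility is exactly the
  -- rank bound at `r`.
  have h1 := hf {v | v ≠ r} (by simp)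
  have h2 : Net.cutOff Set.univ {v | v ≠ r} = ∅ := by
    ext; simp [cutOff]
  have h3 : Net.outSpan F src (vec c) Set.univ {v | v ≠ r} =
      span F (vec c '' {a | Net.loc src a = r}) := by
    unfold outSpan
    congr 2
    ext a
    simp
  rwa [h2, h3, Set.ncard_empty, add_zero] at h1

end Probability

end Network

/-! ### Transfer matrices -/

namespace Network

open Module Submodule

section MinCut

variable {V : Type x} {E : Type y}

theorem minCut_le (Net : Network V E) {src : Set V} {r : V} {S : Set V} (h : src ⊆ S)
    (hr : r ∉ S) : Net.minCut src r ≤ {e : E | Net.tail e ∈ S ∧ Net.head e ∉ S}.ncard :=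
  Nat.sInf_le ⟨S, h, hr, rfl⟩

/-- No set contains `src` and avoids `r`, and the infimum of the empty set of naturals is 0. A
positive minimum cut therefore shows that a source differs from the receiver. -/
theorem minCut_eq_zero (Net : Network V E) {src : Set V} {r : V} (h : r ∈ src) :
    Net.minCut src r = 0 := by
  have : {m : ℕ | ∃ S : Set V, src ⊆ S ∧ r ∉ S ∧
      m = {e : E | Net.tail e ∈ S ∧ Net.head e ∉ S}.ncard} = ∅ := by
    ext m
    simp only [Set.mem_ofPred_eq, Set.mem_empty_iff_false, iff_false]
    rintro ⟨S, hS, hr, -⟩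
    exact hr (hS h)
  rw [minCut, this, Nat.sInf_empty]

end MinCut

section Transfer

variable {V : Type x} {E : Type y} {K : Type u} [Field K] [Fintype E]

/-- Forwarding acts alike on every packet position, so it commutes with expanding the local inputs
in fixed packets `g`. This separates the transfer coefficients from the contents. -/
theorem flow_combination {X γ : Type*} [Fintype X] (Net : Network V E) (a : E → E → K)
    (b : E → X → K) (g : X → γ → K) (e : E) :
    Net.flow a (fun e => ∑ t, b e t • g t) e = ∑ t, Net.flow a b e t • g t := by
  classical
  induction e using Net.wellFounded_precedes.induction with
  | _ e ih =>
    rw [flow_eq, flow_eq Net a b]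
    have h1 : ∀ e' ∈ (Finset.univ : Finset E), (if Net.head e' = Net.tail e then
        a e' e • Net.flow a (fun e => ∑ t, b e t • g t) e' else 0) =
        ∑ t, (if Net.head e' = Net.tail e then a e' e • Net.flow a b e' else 0) t • g t := by
      intro e' _
      split_ifs with h
      · rw [ih e' h, Finset.smul_sum]
        exact Finset.sum_congr rfl fun t _ => by rw [Pi.smul_apply, smul_assoc]
      · simp
    rw [Finset.sum_congr rfl h1, Finset.sum_comm, ← Finset.sum_add_distrib]
    refine Finset.sum_congr rfl fun t _ => ?_
    rw [Pi.add_apply, add_smul, Finset.sum_apply, Finset.sum_smul]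

open Classical in
/-- The coefficients with which the packets of the two sources and the injected packets enter the
packets on the edges. -/
noncomputable def transfer {n N : ℕ} (Net : Network V E) (s₁ s₂ : V) (c : Coeffs K E n N) :
    E → (Fin n ⊕ Fin N) ⊕ E → K :=
  Net.flow (fun e' e => c (.inl e') e) fun e =>
    Sum.elim (Sum.elim (fun l => if Net.tail e = s₁ then c (.inr (.inl l)) e else 0)
      fun l => if Net.tail e = s₂ then c (.inr (.inr l)) e else 0) (Pi.single e 1)

/-- The channel law. The transfer coefficients involve neither messages nor injected packets, so
probability statements about them hold for all choices of the adversary at once. -/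
theorem received_row {γ : Type*} {n N C : ℕ} (Net : Network V E) (s₁ s₂ : V) {r : V}
    (recv : Fin C ≃ {e : E // Net.head e = r}) (c : Coeffs K E n N) (m₁ : Matrix (Fin n) γ K)
    (m₂ : Matrix (Fin N) γ K) (inj : E → γ → K) (i : Fin C) :
    (fun j => Net.received s₁ s₂ recv c m₁ m₂ inj i j) =
      ∑ l, Net.transfer s₁ s₂ c (recv i) (.inl (.inl l)) • m₁ l +
        ∑ l, Net.transfer s₁ s₂ c (recv i) (.inl (.inr l)) • m₂ l +
        ∑ e, Net.transfer s₁ s₂ c (recv i) (.inr e) • inj e := by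
  classical
  have h := Net.flow_combination (fun e' e => c (.inl e') e) (fun e =>
    Sum.elim (Sum.elim (fun l => if Net.tail e = s₁ then c (.inr (.inl l)) e else 0)
      fun l => if Net.tail e = s₂ then c (.inr (.inr l)) e else 0) (Pi.single e 1))
    (Sum.elim (Sum.elim m₁ m₂) inj) (recv i)
  simp only [Fintype.sum_sum_type, Sum.elim_inl, Sum.elim_inr] at h
  refine Eq.trans ?_ h
  show Net.packets s₁ s₂ c m₁ m₂ inj (recv i) = _
  unfold packets
  congr 1
  funext e
  congr 1
  · congr 1
    · split_ifs
      · rfl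
      · exact (Finset.sum_eq_zero fun _ _ => zero_smul K _).symm
    · split_ifs
      · rfl
      · exact (Finset.sum_eq_zero fun _ _ => zero_smul K _).symm
  · simp [Pi.single_apply]

open Classical in
theorem transfer_eq {n N : ℕ} (Net : Network V E) (s₁ s₂ : V) (c : Coeffs K E n N) (e : E)
    (l : Fin n ⊕ Fin N) :
    Net.transfer s₁ s₂ c e (.inl l) =
      (if Sum.elim (fun _ => s₁) (fun _ => s₂) l = Net.tail e then c (.inr l) e else 0) +
        ∑ e', if Net.head e' = Net.tail e then
          c (.inl e') e * Net.transfer s₁ s₂ c e' (.inl l) else 0 := by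
  unfold transfer
  rw [flow_eq, Pi.add_apply, Finset.sum_apply]
  congr 1
  · rcases l with l | l <;> simp [eq_comm] <;> congr
  · refine Finset.sum_congr rfl fun e' _ => ?_
    split_ifs <;> simp

end Transfer

section Decodable

variable {V : Type x} {E : Type y} {K : Type u} [Field K] [Fintype E]
  {F : Type*} [Field F] [Algebra K F] {U₁ U₂ : Type*} [AddCommGroup U₁] [Module F U₁] [Module K U₁]
  [IsScalarTower K F U₁] [AddCommGroup U₂] [Module F U₂] [Module K U₂] [IsScalarTower K F U₂]

/-- If the minimum cuts allow it, then the received combinations of vectors `u₁` at the first source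
and `u₂` at the second source span the whole space for all but a fraction `|E| / |K|` of the
coefficients. -/
theorem ncard_span_ne_top_mul_card_le [Finite K] [FiniteDimensional F U₁]
    [FiniteDimensional F U₂] {n N C : ℕ} (Net : Network V E) (s₁ s₂ : V) {r : V}
    (recv : Fin C ≃ {e : E // Net.head e = r}) (u₁ : Fin n → U₁) (u₂ : Fin N → U₂)
    (hu₁ : span F (Set.range u₁) = ⊤) (hu₂ : span F (Set.range u₂) = ⊤)
    (hr₁ : s₁ ≠ r) (hr₂ : s₂ ≠ r)
    (h₁ : finrank F U₁ ≤ Net.minCut {s₁} r) (h₂ : finrank F U₂ ≤ Net.minCut {s₂} r)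
    (h₁₂ : finrank F U₁ + finrank F U₂ ≤ Net.minCut {s₁, s₂} r) :
    {c : Coeffs K E n N | span F (Set.range fun i : Fin C =>
      ((∑ l, Net.transfer s₁ s₂ c (recv i) (.inl (.inl l)) • u₁ l,
        ∑ l, Net.transfer s₁ s₂ c (recv i) (.inl (.inr l)) • u₂ l) : U₁ × U₂)) ≠ ⊤}.ncard *
          Nat.card K ≤ Fintype.card E * Nat.card (Coeffs K E n N) := by
  classical
  let src : Fin n ⊕ Fin N → V := Sum.elim (fun _ => s₁) fun _ => s₂
  let w : Fin n ⊕ Fin N → U₁ × U₂ := Sum.elim (fun l => (u₁ l, 0)) fun l => (0, u₂ l)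
  let pkt : Coeffs K E n N → E → U₁ × U₂ := fun c e =>
    ∑ l, Net.transfer s₁ s₂ c e (.inl l) • w l
  let vec : Coeffs K E n N → E ⊕ (Fin n ⊕ Fin N) → U₁ × U₂ := fun c => Sum.elim (pkt c) w
  have hw₁ : ∀ W : Submodule F (U₁ × U₂), (∀ l, w (.inl l) ∈ W) →
      LinearMap.range (LinearMap.inl F U₁ U₂) ≤ W := by
    intro W hW
    rw [LinearMap.range_eq_map, ← hu₁, map_span, span_le]
    rintro _ ⟨_, ⟨l, rfl⟩, rfl⟩
    exact hW l
  have hw₂ : ∀ W : Submodule F (U₁ × U₂), (∀ l, w (.inr l) ∈ W) →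
      LinearMap.range (LinearMap.inr F U₁ U₂) ≤ W := by
    intro W hW
    rw [LinearMap.range_eq_map, ← hu₂, map_span, span_le]
    rintro _ ⟨_, ⟨l, rfl⟩, rfl⟩
    exact hW l
  have hd₁ := LinearMap.finrank_range_of_inj (LinearMap.inl_injective (R := F) (M := U₁) (M₂ := U₂))
  have hd₂ := LinearMap.finrank_range_of_inj (LinearMap.inr_injective (R := F) (M := U₁) (M₂ := U₂))
  refine le_trans (Nat.mul_le_mul_right _ (Set.ncard_le_ncard ?_))
    (Net.ncard_rank_lt_mul_card_le (F := F) src r (finrank F U₁ + finrank F U₂) vec w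
      (fun _ _ => rfl) ?_ ?_)
  · intro c hc hm
    refine hc ?_
    have h : vec c '' {a | Net.loc src a = r} = Set.range fun i : Fin C =>
      ((∑ l, Net.transfer s₁ s₂ c (recv i) (.inl (.inl l)) • u₁ l,
        ∑ l, Net.transfer s₁ s₂ c (recv i) (.inl (.inr l)) • u₂ l) : U₁ × U₂) := by
      have hp : ∀ e, pkt c e = (∑ l, Net.transfer s₁ s₂ c e (.inl (.inl l)) • u₁ l,
          ∑ l, Net.transfer s₁ s₂ c e (.inl (.inr l)) • u₂ l) := by
        intro e
        simp only [pkt, Fintype.sum_sum_type, w, Sum.elim_inl, Sum.elim_inr]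
        ext <;> simp [Prod.fst_sum, Prod.snd_sum]
      ext a
      constructor
      · rintro ⟨e | l, hl, rfl⟩
        · exact ⟨recv.symm ⟨e, hl⟩, by simp [vec, hp]⟩
        -- Packets at the sources are not received: only edges are listed by `recv`, which is why
        -- `s₁` and `s₂` must differ from `r`.
        · rcases l with l | l
          exacts [absurd hl hr₁, absurd hl hr₂]
      · rintro ⟨i, rfl⟩
        exact ⟨.inl (recv i), (recv i).2, hp _⟩
    rw [← h]
    refine eq_top_of_finrank_eq (le_antisymm (finrank_le _) ?_)
    rwa [finrank_prod]
  · intro c e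
    simp only [vec, pkt, Sum.elim_inl, Fintype.sum_sum_type (α₁ := E), Sum.elim_inr]
    simp only [Net.transfer_eq s₁ s₂ c e, add_smul, Finset.sum_add_distrib]
    rw [add_comm]
    congr 1
    · simp only [Finset.sum_smul]
      rw [Finset.sum_comm]
      refine Finset.sum_congr rfl fun e' _ => ?_
      by_cases h : Net.head e' = Net.tail e
      · simp [loc, h, Finset.smul_sum, mul_smul, Fintype.sum_sum_type]
      · simp [loc, h]
    · refine Finset.sum_congr rfl fun l _ => ?_
      by_cases h : src l = Net.tail e
      · have h' := h
        simp only [src] at h'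
        simp [loc, h, h']
      · have h' := h
        simp only [src] at h'
        simp [loc, h, h']
  -- Each source outside `S` contributes its full space to the span; the minimum cut from the
  -- sources inside `S` supplies the remaining dimension.
  · intro S hr
    have h1 : s₁ ∉ S → LinearMap.range (LinearMap.inl F U₁ U₂) ≤
        span F (w '' {i | src i ∉ S}) := fun h =>
      hw₁ _ fun l => subset_span ⟨.inl l, h, rfl⟩
    have h2 : s₂ ∉ S → LinearMap.range (LinearMap.inr F U₁ U₂) ≤
        span F (w '' {i | src i ∉ S}) := fun h =>
      hw₂ _ fun l => subset_span ⟨.inr l, h, rfl⟩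
    by_cases hs₁ : s₁ ∈ S <;> by_cases hs₂ : s₂ ∈ S
    · have := Net.minCut_le (src := {s₁, s₂}) (S := S)
        (Set.insert_subset hs₁ (Set.singleton_subset_iff.mpr hs₂)) hr
      omega
    · have := Net.minCut_le (src := {s₁}) (S := S) (Set.singleton_subset_iff.mpr hs₁) hr
      have := finrank_mono (h2 hs₂)
      omega
    · have := Net.minCut_le (src := {s₂}) (S := S) (Set.singleton_subset_iff.mpr hs₂) hr
      have := finrank_mono (h1 hs₁)
      omega
    · have h3 := sup_le (h1 hs₁) (h2 hs₂)
      rw [LinearMap.sup_range_inl_inr, top_le_iff] at h3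
      rw [h3, finrank_top, finrank_prod]
      omega

end Decodable

end Network

/-! ### Straight-line computation of families of functions -/

namespace StraightLine

open Module Submodule

variable {Ω : Type*} {K : Type*} [Field K]

open Classical in
/-- The functions which one operation produces from the functions in `T`. -/
inductive OneStep (T : Set (Ω → K)) : (Ω → K) → Prop
  | const (a : K) : OneStep T fun _ => a
  | add {f g : Ω → K} (hf : f ∈ T) (hg : g ∈ T) : OneStep T (f + g)
  | sub {f g : Ω → K} (hf : f ∈ T) (hg : g ∈ T) : OneStep T (f - g)
  | mul {f g : Ω → K} (hf : f ∈ T) (hg : g ∈ T) : OneStep T (f * g)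
  | inv {f : Ω → K} (hf : f ∈ T) : OneStep T f⁻¹
  | sel {f g h : Ω → K} (hf : f ∈ T) (hg : g ∈ T) (hh : h ∈ T) :
      OneStep T fun ω => if f ω = 0 then g ω else h ω

/-- `T` arises from `I` by adjoining, `c` times, the result of one operation. -/
inductive Derivable (I : Set (Ω → K)) : ℕ → Set (Ω → K) → Prop
  | base : Derivable I 0 I
  | step {c : ℕ} {T : Set (Ω → K)} {f : Ω → K} (h : Derivable I c T) (hf : OneStep T f) :
      Derivable I (c + 1) (insert f T)

/-- All functions in `T` can be computed from those in `I` with at most `c` operations. -/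
def Computes (I : Set (Ω → K)) (c : ℕ) (T : Set (Ω → K)) : Prop :=
  ∃ c' ≤ c, ∃ T', T ⊆ T' ∧ Derivable I c' T'

variable {I J T T' : Set (Ω → K)} {c c' : ℕ} {f g h : Ω → K}

theorem OneStep.mono (hf : OneStep T f) (h : T ⊆ T') : OneStep T' f := by
  cases hf with
  | const a => exact .const a
  | add h1 h2 => exact .add (h h1) (h h2)
  | sub h1 h2 => exact .sub (h h1) (h h2)
  | mul h1 h2 => exact .mul (h h1) (h h2)
  | inv h1 => exact .inv (h h1)
  | sel h1 h2 h3 => exact .sel (h h1) (h h2) (h h3)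

theorem Derivable.base_subset (h : Derivable I c T) : I ⊆ T := by
  induction h with
  | base => exact subset_rfl
  | step _ _ ih => exact ih.trans (Set.subset_insert _ _)

theorem Derivable.trans (h : Derivable I c T) (h' : Derivable T c' T') :
    Derivable I (c + c') T' := by
  induction h' with
  | base => exact h
  | step _ hf ih => exact .step ih hf

theorem Derivable.change_base (h : Derivable I c T) (hIJ : I ⊆ J) :
    ∃ T', T ⊆ T' ∧ Derivable J c T' := by
  induction h with
  | base => exact ⟨J, hIJ, .base⟩
  | step _ hf ih =>
    obtain ⟨T', h1, h2⟩ := ih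
    exact ⟨_, Set.insert_subset_insert h1, .step h2 (hf.mono h1)⟩

theorem Computes.mono (h : Computes I c T) (hc : c ≤ c') (hT : T' ⊆ T) : Computes I c' T' := by
  obtain ⟨d, hd, S, hS, h⟩ := h
  exact ⟨d, hd.trans hc, S, hT.trans hS, h⟩

theorem Computes.of_subset (h : T ⊆ I) : Computes I c T := ⟨0, Nat.zero_le _, I, h, .base⟩

theorem Computes.trans (h : Computes I c T) (h' : Computes (I ∪ T) c' T') :
    Computes I (c + c') (T ∪ T') := by
  obtain ⟨d, hd, S, hS, h⟩ := h
  obtain ⟨d', hd', S', hS', h'⟩ := h'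
  obtain ⟨S'', h1, h2⟩ := h'.change_base (Set.union_subset h.base_subset hS)
  exact ⟨d + d', Nat.add_le_add hd hd', S'',
    Set.union_subset (hS.trans h2.base_subset) (hS'.trans h1), h.trans h2⟩

theorem Computes.change_base (h : Computes I c T) (hIJ : I ⊆ J) : Computes J c T := by
  obtain ⟨d, hd, S, hS, h⟩ := h
  obtain ⟨S', h1, h2⟩ := h.change_base hIJ
  exact ⟨d, hd, S', hS.trans h1, h2⟩

theorem Computes.union (h : Computes I c T) (h' : Computes I c' T') :
    Computes I (c + c') (T ∪ T') :=
  h.trans (h'.change_base Set.subset_union_left)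

theorem Computes.iUnion {ι : Type*} [Fintype ι] {S : ι → Set (Ω → K)}
    (h : ∀ i, Computes I c (S i)) : Computes I (Fintype.card ι * c) (⋃ i, S i) := by
  classical
  have : ∀ s : Finset ι, Computes I (s.card * c) (⋃ i ∈ s, S i) := by
    intro s
    induction s using Finset.induction_on with
    | empty => exact Computes.of_subset (by simp)
    | insert a s ha ih =>
      rw [Finset.card_insert_of_notMem ha, Finset.set_biUnion_insert]
      exact ((h a).union ih).mono (by rw [add_mul, one_mul, add_comm]) subset_rfl
  simpa using this Finset.univ

theorem Computes.range {ι : Type*} [Fintype ι] {f : ι → Ω → K}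
    (h : ∀ i, Computes I c {f i}) : Computes I (Fintype.card ι * c) (Set.range f) := by
  have := Computes.iUnion h
  rwa [Set.iUnion_singleton_eq_range] at this

theorem Computes.one (h : OneStep I f) : Computes I 1 {f} :=
  ⟨1, le_rfl, _, by simp, .step .base h⟩

theorem Computes.sum_mul {m : ℕ} {f g : Fin m → Ω → K} (hf : ∀ j, f j ∈ I) (hg : ∀ j, g j ∈ I) :
    Computes I (2 * m + 1) {∑ j, f j * g j} := by
  induction m with
  | zero => exact Computes.one (.const 0)
  | succ m ih =>
    have h1 := ih (fun j => hf j.castSucc) (fun j => hg j.castSucc)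
    have h2 := h1.union (Computes.one (.mul (hf (Fin.last m)) (hg (Fin.last m))))
    have h3 := h2.trans (Computes.one (.add (T := I ∪ _) (Or.inr (Or.inl rfl))
      (Or.inr (Or.inr rfl))))
    rw [Fin.sum_univ_castSucc]
    refine h3.mono (by omega) ?_
    exact Set.subset_union_right

theorem Computes.linear_combination {m : ℕ} (a : Fin m → K) {g : Fin m → Ω → K}
    (hg : ∀ j, g j ∈ I) : Computes I (3 * m + 1) {∑ j, a j • g j} := by
  have h1 : Computes I (Fintype.card (Fin m) * 1) (Set.range fun j : Fin m => fun _ : Ω => a j) :=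
    Computes.range fun j => Computes.one (.const _)
  have h2 := h1.trans (Computes.sum_mul (f := fun j => fun _ : Ω => a j) (g := g)
    (fun j => Or.inr ⟨j, rfl⟩) (fun j => Or.inl (hg j)))
  refine h2.mono (by simp; omega) ?_
  rintro _ rfl
  refine Or.inr ?_
  rw [Set.mem_singleton_iff]
  rfl

/-- Selection of a pivot: a vector `τ` with `∑ cⱼ τⱼ = 1` unless `c = 0`. -/
theorem exists_pivot {m : ℕ} {a : Fin m → Ω → K} (ha : ∀ j, a j ∈ I) :
    ∃ (τ : Fin m → Ω → K) (φ : Ω → K), Computes I (3 * m + 1) (Set.range τ ∪ {φ, 0}) ∧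
      ∀ ω, φ ω = 0 ∧ (∀ j, a j ω = 0) ∧ (∀ j, τ j ω = 0) ∨
        φ ω ≠ 0 ∧ ∑ j, a j ω * τ j ω = 1 := by
  induction m with
  | zero =>
    refine ⟨Fin.elim0, 0, (Computes.one (.const 0)).mono le_rfl ?_, fun ω => Or.inl (by simp)⟩
    rintro _ (⟨j, -⟩ | rfl | rfl)
    exacts [j.elim0, rfl, rfl]
  | succ m ih =>
    obtain ⟨τ, φ, h1, h2⟩ := ih fun j => ha j.castSucc
    classical
    -- `φ` holds the first nonzero entry seen so far, and `τ` its inverse in that position. The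
    -- convention `0⁻¹ = 0` makes the new entry vanish when no pivot has been found yet.
    let t : Ω → K := fun ω => if φ ω = 0 then (a (Fin.last m))⁻¹ ω else (0 : Ω → K) ω
    let φ' : Ω → K := fun ω => if φ ω = 0 then a (Fin.last m) ω else φ ω
    refine ⟨Fin.snoc τ t, φ', ?_, ?_⟩
    · have h3 := h1.union (Computes.one (.inv (ha (Fin.last m))))
      have h4 : Computes (I ∪ (Set.range τ ∪ {φ, 0} ∪ {(a (Fin.last m))⁻¹})) 1 {t} := by
        exact Computes.one (.sel (T := I ∪ (Set.range τ ∪ {φ, 0} ∪ {(a (Fin.last m))⁻¹}))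
          (f := φ) (g := (a (Fin.last m))⁻¹) (h := 0) (by simp) (by simp) (by simp))
      have h5 : Computes (I ∪ (Set.range τ ∪ {φ, 0} ∪ {(a (Fin.last m))⁻¹})) 1 {φ'} := by
        exact Computes.one (.sel (T := I ∪ (Set.range τ ∪ {φ, 0} ∪ {(a (Fin.last m))⁻¹}))
          (f := φ) (g := a (Fin.last m)) (h := φ) (by simp) (by simp [ha]) (by simp))
      refine (h3.trans (h4.union h5)).mono (by omega) ?_
      rintro f (⟨j, rfl⟩ | rfl | rfl)
      · refine Fin.lastCases ?_ (fun j => ?_) j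
        · rw [Fin.snoc_last]; simp
        · rw [Fin.snoc_castSucc]; exact Or.inl (Or.inl (Or.inl ⟨j, rfl⟩))
      · simp
      · simp
    · intro ω
      rw [Fin.sum_univ_castSucc, Fin.snoc_last]
      simp only [Fin.snoc_castSucc]
      rcases h2 ω with ⟨h3, h4, h5⟩ | ⟨h3, h4⟩
      · by_cases h6 : a (Fin.last m) ω = 0
        · refine Or.inl ⟨by simp [φ', h3, h6], fun j => ?_, fun j => ?_⟩
          · exact Fin.lastCases h6 h4 j
          · refine Fin.lastCases ?_ (fun j => ?_) j
            · simp [t, h3, h6]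
            · simp [h5]
        · exact Or.inr ⟨by simp [φ', h3, h6], by simp [t, h3, h4, h6]⟩
      · exact Or.inr ⟨by simp [φ', h3], by simp [t, h3, h4]⟩

/-- One step of the elimination: the solutions `x₀ + B t` are cut down by one more equation. -/
theorem exists_elimination_step {m : ℕ} {a x₀ : Fin m → Ω → K} {β : Ω → K}
    {B : Fin m → Fin m → Ω → K} (ha : ∀ j, a j ∈ I) (hx : ∀ j, x₀ j ∈ I) (hβ : β ∈ I)
    (hB : ∀ j k, B j k ∈ I) :
    ∃ (x₁ : Fin m → Ω → K) (B₁ : Fin m → Fin m → Ω → K) (v : Ω → Fin m → K),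
      Computes I (18 * (m + 1) ^ 2)
        (Set.range x₁ ∪ Set.range fun p : Fin m × Fin m => B₁ p.1 p.2) ∧
      ∀ ω, (∃ τ : Fin m → K, ∀ j, v ω j = ∑ k, B j k ω * τ k) ∧
        (∀ j, x₁ j ω = x₀ j ω + (β ω - ∑ i, a i ω * x₀ i ω) * v ω j) ∧
        (∀ j k, B₁ j k ω = B j k ω - v ω j * ∑ i, a i ω * B i k ω) ∧
        ((∀ k, ∑ i, a i ω * B i k ω = 0) ∨ ∑ j, a j ω * v ω j = 1) := by
  let d : Fin m → Ω → K := fun k => ∑ i, a i * B i k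
  have c1 : Computes I (m * (2 * m + 1)) (Set.range d) := by
    simpa using Computes.range fun k => Computes.sum_mul ha (fun i => hB i k)
  obtain ⟨τ, φ, c2, hτ⟩ := exists_pivot (I := I ∪ Set.range d) (a := d) fun k => Or.inr ⟨k, rfl⟩
  have c3 := c1.trans (c2.mono le_rfl Set.subset_union_left)
  -- A direction in the column space of `B`, normalized to `a · v = 1` when the new equation is not
  -- constant along the current solutions. Adding the residual `r` times `v` then meets the
  -- equation, and subtracting `v d` from `B` removes the directions that violate it.
  let v : Fin m → Ω → K := fun j => ∑ k, B j k * τ k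
  let r : Ω → K := β - ∑ i, a i * x₀ i
  have c4 : Computes (I ∪ (Set.range d ∪ Set.range τ)) (m * (2 * m + 1)) (Set.range v) := by
    simpa using Computes.range fun j => Computes.sum_mul (I := I ∪ (Set.range d ∪ Set.range τ))
      (fun k => Or.inl (hB j k)) (fun k => Or.inr (Or.inr ⟨k, rfl⟩))
  have c5 := c3.trans c4
  have c6 : Computes I (2 * m + 1 + 1) ({∑ i, a i * x₀ i} ∪ {r}) :=
    (Computes.sum_mul ha hx).trans (Computes.one (.sub (Or.inl hβ) (Or.inr rfl)))
  have c7 := c5.union c6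
  set S := I ∪ (Set.range d ∪ Set.range τ ∪ Set.range v ∪ ({∑ i, a i * x₀ i} ∪ {r})) with hS
  have hv : ∀ j, v j ∈ S := fun j => Or.inr (Or.inl (Or.inr ⟨j, rfl⟩))
  have hr : r ∈ S := Or.inr (Or.inr (Or.inr rfl))
  have hd : ∀ k, d k ∈ S := fun k => Or.inr (Or.inl (Or.inl (Or.inl ⟨k, rfl⟩)))
  have c8 : Computes S (m * 2) (Set.range fun j => x₀ j + r * v j) := by
    simpa using Computes.range (ι := Fin m) (f := fun j => x₀ j + r * v j) (I := S) (c := 2)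
      fun j => ((Computes.one (.mul hr (hv j))).trans
        (Computes.one (.add (Or.inl (Or.inl (hx j))) (Or.inr rfl)))).mono le_rfl
          Set.subset_union_right
  have c9 : Computes S (m * m * 2)
      (Set.range fun p : Fin m × Fin m => B p.1 p.2 - v p.1 * d p.2) := by
    simpa using Computes.range (ι := Fin m × Fin m) (f := fun p => B p.1 p.2 - v p.1 * d p.2)
      (I := S) (c := 2) fun p => ((Computes.one (.mul (hv p.1) (hd p.2))).trans
        (Computes.one (.sub (Or.inl (Or.inl (hB p.1 p.2))) (Or.inr rfl)))).mono le_rfl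
          Set.subset_union_right
  refine ⟨fun j => x₀ j + r * v j, fun j k => B j k - v j * d k, fun ω j => v j ω,
    (c7.trans (c8.union c9)).mono (by nlinarith) Set.subset_union_right, fun ω => ⟨?_, ?_, ?_, ?_⟩⟩
  · exact ⟨fun k => τ k ω, fun j => by simp [v]⟩
  · intro j
    simp [r]
  · intro j k
    simp [d]
  · rcases hτ ω with ⟨-, h, -⟩ | ⟨-, h⟩
    · exact Or.inl fun k => by simpa [d] using h k
    · refine Or.inr ?_
      rw [← h]
      simp only [v, d, Finset.sum_apply, Pi.mul_apply, Finset.mul_sum, Finset.sum_mul]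
      rw [Finset.sum_comm]
      exact Finset.sum_congr rfl fun _ _ => Finset.sum_congr rfl fun _ _ => by ring

/-- Only one inclusion is maintained: every solution lies in `x₀` plus the columns of `B`, and all
equations vanish on these columns. If a solution exists, it differs from `x₀` by a vector killed by
all equations, so `x₀` solves the system; inconsistent systems need no treatment. -/
theorem exists_elimination {m : ℕ} (L : List ((Fin m → Ω → K) × (Ω → K)))
    (hL : ∀ q ∈ L, (∀ j, q.1 j ∈ I) ∧ q.2 ∈ I) :
    ∃ (x₀ : Fin m → Ω → K) (B : Fin m → Fin m → Ω → K),
      Computes I (L.length * (18 * (m + 1) ^ 2) + 2)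
        (Set.range x₀ ∪ Set.range fun p : Fin m × Fin m => B p.1 p.2) ∧
      ∀ ω, (∀ x : Fin m → K, (∀ q ∈ L, ∑ j, q.1 j ω * x j = q.2 ω) →
          ∃ t : Fin m → K, ∀ j, x j = x₀ j ω + ∑ k, B j k ω * t k) ∧
        ∀ q ∈ L, ∀ k, ∑ j, q.1 j ω * B j k ω = 0 := by
  induction L with
  | nil =>
    refine ⟨fun _ _ => 0, fun j k _ => if j = k then 1 else 0, ?_,
      fun ω => ⟨fun x _ => ?_, by simp⟩⟩
    · refine ((Computes.one (.const 0)).union (Computes.one (.const 1))).mono (by simp) ?_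
      rintro f (⟨j, rfl⟩ | ⟨⟨j, k⟩, rfl⟩)
      · exact Or.inl rfl
      · by_cases h : j = k
        · exact Or.inr (by simp [h])
        · exact Or.inl (by simp [h])
    · exact ⟨x, by simp⟩
  | cons q L ih =>
    obtain ⟨x₀, B, c1, h1⟩ := ih fun q hq => hL q (List.mem_cons_of_mem _ hq)
    obtain ⟨hq1, hq2⟩ := hL q List.mem_cons_self
    obtain ⟨x₁, B₁, v, c2, h2⟩ := exists_elimination_step
      (I := I ∪ (Set.range x₀ ∪ Set.range fun p : Fin m × Fin m => B p.1 p.2))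
      (a := q.1) (x₀ := x₀) (β := q.2) (B := B) (fun j => Or.inl (hq1 j))
      (fun j => Or.inr (Or.inl ⟨j, rfl⟩)) (Or.inl hq2)
      (fun j k => Or.inr (Or.inr ⟨(j, k), rfl⟩))
    refine ⟨x₁, B₁, (c1.trans c2).mono ?_ Set.subset_union_right, fun ω => ?_⟩
    · rw [List.length_cons]; ring_nf; omega
    obtain ⟨h3, h4⟩ := h1 ω
    obtain ⟨⟨τ, hτ⟩, hx, hB, hv⟩ := h2 ω
    refine ⟨fun x hxL => ?_, fun p hp k => ?_⟩
    · obtain ⟨t, ht⟩ := h3 x fun q hq => hxL q (List.mem_cons_of_mem _ hq)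
      refine ⟨t, fun j => ?_⟩
      have h5 := hxL q List.mem_cons_self
      -- The same parameter `t` still works: the residual of `x₀` is `d · t` with `d = a B`, so the
      -- corrections to `x₀` and to `B` cancel, whether or not there is a pivot.
      have h6 : q.2 ω - ∑ i, q.1 i ω * x₀ i ω = ∑ k, (∑ i, q.1 i ω * B i k ω) * t k := by
        rw [← h5, ← Finset.sum_sub_distrib]
        simp only [Finset.sum_mul]
        rw [Finset.sum_comm]
        refine Finset.sum_congr rfl fun i _ => ?_
        rw [ht i, mul_add, add_sub_cancel_left, Finset.mul_sum]
        exact Finset.sum_congr rfl fun _ _ => by ring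
      rw [ht j, hx j, h6]
      simp only [hB, sub_mul, Finset.sum_sub_distrib]
      rw [Finset.sum_mul]
      have : ∀ k, v ω j * (∑ i, q.1 i ω * B i k ω) * t k =
        (∑ i, q.1 i ω * B i k ω) * t k * v ω j := fun k => by ring
      simp only [this]
      ring
    · have h7 : ∑ j, p.1 j ω * B₁ j k ω = ∑ j, p.1 j ω * B j k ω -
          (∑ j, p.1 j ω * v ω j) * ∑ i, q.1 i ω * B i k ω := by
        simp only [hB, mul_sub, Finset.sum_sub_distrib, Finset.sum_mul]
        congr 1
        exact Finset.sum_congr rfl fun _ _ => by ring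
      rw [h7]
      rcases List.mem_cons.mp hp with rfl | hp
      · rcases hv with hv | hv
        · rw [hv k]; ring
        · rw [hv]; ring
      -- Earlier equations vanish on `B`, hence on `v`, which is a combination of its columns.
      · have h8 : ∑ j, p.1 j ω * v ω j = 0 := by
          simp only [hτ, Finset.mul_sum]
          rw [Finset.sum_comm]
          refine Finset.sum_eq_zero fun k _ => ?_
          have := congrArg (· * τ k) (h4 p hp k)
          simp only [Finset.sum_mul, zero_mul] at this
          rw [← this]
          exact Finset.sum_congr rfl fun _ _ => by ring
        rw [h4 p hp k, h8]; ring

/-- A straight-line program that solves solvable systems of linear equations. -/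
theorem exists_solve {m : ℕ} {μ : Type*} [Fintype μ] {a : μ → Fin m → Ω → K} {β : μ → Ω → K}
    (ha : ∀ i j, a i j ∈ I) (hβ : ∀ i, β i ∈ I) :
    ∃ x : Fin m → Ω → K, Computes I (Fintype.card μ * (18 * (m + 1) ^ 2) + 2) (Set.range x) ∧
      ∀ ω, (∃ x' : Fin m → K, ∀ i, ∑ j, a i j ω * x' j = β i ω) →
        ∀ i, ∑ j, a i j ω * x j ω = β i ω := by
  obtain ⟨x₀, B, c, h⟩ := exists_elimination (I := I)
    ((Finset.univ : Finset μ).toList.map fun i => (a i, β i)) (by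
      intro q hq
      obtain ⟨i, -, rfl⟩ := List.mem_map.mp hq
      exact ⟨ha i, hβ i⟩)
  refine ⟨x₀, c.mono (by simp) Set.subset_union_left, fun ω ⟨x', hx'⟩ i => ?_⟩
  obtain ⟨h1, h2⟩ := h ω
  obtain ⟨t, ht⟩ := h1 x' (by
    intro q hq
    obtain ⟨i, -, rfl⟩ := List.mem_map.mp hq
    exact hx' i)
  have h3 := h2 (a i, β i) (List.mem_map.mpr ⟨i, by simp, rfl⟩)
  rw [← hx' i]
  simp only [ht, mul_add, Finset.sum_add_distrib, Finset.mul_sum]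
  rw [Finset.sum_comm (f := fun j k => a i j ω * (B j k ω * t k))]
  have : ∑ k, ∑ j, a i j ω * (B j k ω * t k) = 0 := by
    refine Finset.sum_eq_zero fun k _ => ?_
    have := congrArg (· * t k) (h3 k)
    simp only [Finset.sum_mul, zero_mul] at this
    rw [← this]
    exact Finset.sum_congr rfl fun _ _ => by ring
  rw [this, add_zero]

end StraightLine

/-! ### Spans of computed functions, vector-valued functions, and conversion to programs -/

namespace StraightLine

open Module Submodule

variable {Ω : Type*} {K : Type*} [Field K]

section Gen

variable {I : Set (Ω → K)} {c c' m m' : ℕ} {P P' : Submodule K (Ω → K)}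

/-- The functions in `P` are linear combinations of `m` functions which can be computed from
those in `I` with `c` operations. -/
def Gen (I : Set (Ω → K)) (c m : ℕ) (P : Submodule K (Ω → K)) : Prop :=
  ∃ t : Finset (Ω → K), t.card ≤ m ∧ Computes I c t ∧ P ≤ span K (t : Set (Ω → K))

theorem Gen.mono (h : Gen I c m P) (hc : c ≤ c') (hm : m ≤ m') (hP : P' ≤ P) :
    Gen I c' m' P' := by
  obtain ⟨t, h1, h2, h3⟩ := h
  exact ⟨t, h1.trans hm, h2.mono hc subset_rfl, hP.trans h3⟩

theorem computes_of_mem_span {t : Finset (Ω → K)} {f : Ω → K} (ht : t.card ≤ m)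
    (htI : (t : Set (Ω → K)) ⊆ I) (hf : f ∈ span K (t : Set (Ω → K))) :
    Computes I (3 * m + 1) {f} := by
  have hr : Set.range (fun i : Fin t.card => (t.equivFin.symm i : Ω → K)) = t := by
    ext g
    constructor
    · rintro ⟨i, rfl⟩
      exact (t.equivFin.symm i).2
    · intro hg
      exact ⟨t.equivFin ⟨g, hg⟩, by simp⟩
  rw [← hr] at hf
  obtain ⟨a, rfl⟩ := (mem_span_range_iff_exists_fun K).mp hf
  exact (Computes.linear_combination a fun j => htI (t.equivFin.symm j).2).mono (by omega)
    subset_rfl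

theorem Gen.computes {κ : Type*} [Fintype κ] (h : Gen I c m P) {f : κ → Ω → K}
    (hf : ∀ i, f i ∈ P) : Computes I (c + Fintype.card κ * (3 * m + 1)) (Set.range f) := by
  obtain ⟨t, h1, h2, h3⟩ := h
  exact (h2.trans (Computes.range fun i =>
    computes_of_mem_span h1 Set.subset_union_right (h3 (hf i)))).mono le_rfl Set.subset_union_right

/-- Constant linear maps cost nothing at the level of spans; products are paid for by multiplying
all pairs of generators. Passing to the second decoding stage needs this, for the products of
headers with decoded symbols. -/
theorem Gen.mul (h : Gen I c m P) : Gen I (c + m * m) (m + m * m) (P ⊔ P * P) := by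
  classical
  obtain ⟨t, h1, h2, h3⟩ := h
  refine ⟨t ∪ (t ×ˢ t).image fun p => p.1 * p.2, ?_, ?_, ?_⟩
  · refine (Finset.card_union_le _ _).trans (Nat.add_le_add h1 (Finset.card_image_le.trans ?_))
    rw [Finset.card_product]
    exact Nat.mul_le_mul h1 h1
  · have := Computes.range (I := I ∪ t) (c := 1) (ι := ↥t × ↥t)
      (f := fun p => (p.1 : Ω → K) * (p.2 : Ω → K))
      fun p => Computes.one (.mul (Or.inr p.1.2) (Or.inr p.2.2))
    refine (h2.trans this).mono ?_ ?_
    · simp only [Fintype.card_prod, Fintype.card_coe, mul_one]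
      exact Nat.add_le_add_left (Nat.mul_le_mul h1 h1) _
    · rw [Finset.coe_union]
      refine Set.union_subset_union_right _ ?_
      intro f hf
      obtain ⟨p, hp, rfl⟩ := Finset.mem_image.mp (Finset.mem_coe.mp hf)
      rw [Finset.mem_product] at hp
      exact ⟨(⟨p.1, hp.1⟩, ⟨p.2, hp.2⟩), rfl⟩
  · rw [Finset.coe_union, span_union]
    refine sup_le_sup h3 ((mul_le_mul' h3 h3).trans ?_)
    rw [span_mul_span]
    refine span_mono ?_
    rintro _ ⟨f, hf, g, hg, rfl⟩
    exact Finset.mem_coe.mpr (Finset.mem_image.mpr ⟨(f, g), Finset.mem_product.mpr ⟨hf, hg⟩, rfl⟩)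

theorem Gen.iSup {ι : Type*} [Fintype ι] {Q : ι → Submodule K (Ω → K)}
    (h : ∀ i, Gen I c m (Q i)) : Gen I (Fintype.card ι * c) (Fintype.card ι * m) (⨆ i, Q i) := by
  classical
  choose t h1 h2 h3 using h
  refine ⟨Finset.univ.biUnion t, ?_, ?_, ?_⟩
  · exact Finset.card_biUnion_le.trans ((Finset.sum_le_sum fun i _ => h1 i).trans (by simp))
  · refine (Computes.iUnion h2).mono le_rfl ?_
    simp
  · refine iSup_le fun i => (h3 i).trans (span_mono ?_)
    exact Finset.coe_subset.mpr (Finset.subset_biUnion_of_mem t (Finset.mem_univ i))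

end Gen

section VMem

variable {U : Type*} [AddCommGroup U] [Module K U] {W : Type*} [AddCommGroup W] [Module K W]
  {P P' : Submodule K (Ω → K)}

/-- All coordinates of the vector-valued function `y` are in `P`. -/
def VMem (P : Submodule K (Ω → K)) (y : Ω → U) : Prop :=
  ∀ ψ : U →ₗ[K] K, (fun ω => ψ (y ω)) ∈ P

theorem VMem.mono {y : Ω → U} (h : VMem P y) (hP : P ≤ P') : VMem P' y := fun ψ => hP (h ψ)

theorem VMem.map {y : Ω → U} (h : VMem P y) (T : U →ₗ[K] W) : VMem P fun ω => T (y ω) :=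
  fun ψ => h (ψ ∘ₗ T)

theorem VMem.add {y y' : Ω → U} (h : VMem P y) (h' : VMem P y') : VMem P fun ω => y ω + y' ω :=
  fun ψ => by simpa only [map_add, Pi.add_def] using P.add_mem (h ψ) (h' ψ)

theorem VMem.sub {y y' : Ω → U} (h : VMem P y) (h' : VMem P y') : VMem P fun ω => y ω - y' ω :=
  fun ψ => by simpa only [map_sub, Pi.sub_def] using P.sub_mem (h ψ) (h' ψ)

theorem VMem.sum {ι : Type*} {s : Finset ι} {y : ι → Ω → U} (h : ∀ i ∈ s, VMem P (y i)) :
    VMem P fun ω => ∑ i ∈ s, y i ω := by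
  intro ψ
  have : (fun ω => ψ (∑ i ∈ s, y i ω)) = ∑ i ∈ s, fun ω => ψ (y i ω) := by
    ext ω; simp
  rw [this]
  exact P.sum_mem fun i hi => h i hi ψ

theorem VMem.smul_const {f : Ω → K} (h : f ∈ P) (u : U) : VMem P fun ω => f ω • u := by
  intro ψ
  have : (fun ω => ψ (f ω • u)) = ψ u • f := by
    ext ω; simp [mul_comm]
  rw [this]
  exact P.smul_mem _ h

theorem VMem.const (h : 1 ∈ P) (u : U) : VMem P fun _ : Ω => u := by
  simpa using VMem.smul_const h u

theorem VMem.smul {f : Ω → K} {y : Ω → U} (hf : f ∈ P) (h : VMem P y) :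
    VMem (P * P) fun ω => f ω • y ω := by
  intro ψ
  have : (fun ω => ψ (f ω • y ω)) = f * fun ω => ψ (y ω) := by
    ext ω; simp
  rw [this]
  exact mul_mem_mul hf (h ψ)

theorem VMem.pi {ι : Type*} [Finite ι] {X : ι → Type*} [∀ i, AddCommGroup (X i)]
    [∀ i, Module K (X i)] {y : Ω → ∀ i, X i} (h : ∀ i, VMem P fun ω => y ω i) : VMem P y := by
  classical
  have := Fintype.ofFinite ι
  intro ψ
  have h1 : (fun ω => ψ (y ω)) =
      ∑ i, fun ω => (ψ ∘ₗ LinearMap.single K X i) (y ω i) := by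
    ext ω
    rw [Finset.sum_apply]
    simp only [LinearMap.comp_apply]
    rw [← map_sum]
    congr 1
    exact (Finset.univ_sum_single (y ω)).symm
  rw [h1]
  exact P.sum_mem fun i _ => h i _

/-- Solving a system of linear equations between finite-dimensional vector spaces. -/
theorem Gen.solve [FiniteDimensional K U] [FiniteDimensional K W] {I : Set (Ω → K)} {c M : ℕ}
    (hP : Gen I c M P) (hM : 1 ≤ M) (hU : finrank K U ≤ M) (hW : finrank K W ≤ M)
    {A : Ω → U →ₗ[K] W} {β : Ω → W} (hA : ∀ u, VMem P fun ω => A ω u) (hβ : VMem P β) :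
    ∃ (x : Ω → U) (P' : Submodule K (Ω → K)), P ≤ P' ∧ Gen I (c + 100 * M ^ 3) (2 * M) P' ∧
      VMem P' x ∧ ∀ ω, (∃ u, A ω u = β ω) → A ω (x ω) = β ω := by
  classical
  obtain ⟨t, h1, h2, h3⟩ := hP
  let bU := finBasis K U
  let bW := finBasis K W
  let a : Fin (finrank K W) → Fin (finrank K U) → Ω → K := fun i j ω => bW.repr (A ω (bU j)) i
  let β' : Fin (finrank K W) → Ω → K := fun i ω => bW.repr (β ω) i
  have ha : ∀ i j, a i j ∈ P := fun i j => hA (bU j) (bW.coord i)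
  have hβ' : ∀ i, β' i ∈ P := fun i => hβ (bW.coord i)
  have c1 := (Computes.range fun p : Fin (finrank K W) × Fin (finrank K U) =>
    computes_of_mem_span (I := I ∪ t) h1 Set.subset_union_right (h3 (ha p.1 p.2))).union
    (Computes.range fun i => computes_of_mem_span (I := I ∪ t) h1 Set.subset_union_right
      (h3 (hβ' i)))
  have c2 := h2.trans c1
  obtain ⟨x, c3, hx⟩ := exists_solve (I := I ∪ (↑t ∪ ((Set.range fun p :
    Fin (finrank K W) × Fin (finrank K U) => a p.1 p.2) ∪ Set.range β'))) (a := a) (β := β')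
    (fun i j => Or.inr (Or.inr (Or.inl ⟨(i, j), rfl⟩))) fun i => Or.inr (Or.inr (Or.inr ⟨i, rfl⟩))
  have c4 := c2.trans c3
  have hrepr : ∀ ω (y : Fin (finrank K U) → K) i, ∑ j, a i j ω * y j =
      bW.repr (A ω (∑ j, y j • bU j)) i := by
    intro ω y i
    simp [a, map_sum, Finsupp.finsetSum_apply, mul_comm]
  refine ⟨fun ω => ∑ j, x j ω • bU j, span K (↑(t ∪ Finset.univ.image x) : Set (Ω → K)), ?_,
    ⟨t ∪ Finset.univ.image x, ?_, c4.mono ?_ ?_, le_rfl⟩, ?_, ?_⟩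
  · exact h3.trans (span_mono (by simp))
  · refine (Finset.card_union_le _ _).trans ?_
    have : (Finset.univ.image x).card ≤ finrank K U := by
      simpa using Finset.card_image_le (s := Finset.univ) (f := x)
    omega
  -- Reading off the matrix costs at most `4 * M ^ 3`, the right-hand side `4 * M ^ 2`, and
  -- elimination `72 * M ^ 3 + 2`, in all below `100 * M ^ 3`.
  · simp only [Fintype.card_prod, Fintype.card_fin]
    set p := finrank K W
    set q := finrank K U
    have e1 : p * q ≤ M * M := Nat.mul_le_mul hW hU
    have e2 : (q + 1) ^ 2 ≤ (2 * M) ^ 2 := Nat.pow_le_pow_left (by omega) 2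
    have e3 : p * q * (3 * M + 1) ≤ M * M * (4 * M) := Nat.mul_le_mul e1 (by omega)
    have e4 : p * (3 * M + 1) ≤ M * (4 * M) := Nat.mul_le_mul hW (by omega)
    have e5 : p * (18 * (q + 1) ^ 2) ≤ M * (18 * (2 * M) ^ 2) := Nat.mul_le_mul hW (by omega)
    have e6 : M * M ≤ M ^ 3 := by
      calc M * M = M * M * 1 := by ring
        _ ≤ M * M * M := Nat.mul_le_mul_left _ hM
        _ = M ^ 3 := by ring
    have e7 : 1 ≤ M ^ 3 := Nat.one_le_pow _ _ hM
    nlinarith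
  · rw [Finset.coe_union, Finset.coe_image, Finset.coe_univ, Set.image_univ]
    exact Set.union_subset_union_left _ Set.subset_union_left
  · refine VMem.sum fun j _ => VMem.smul_const (subset_span ?_) _
    simp
  · rintro ω ⟨u, hu⟩
    have h5 := hx ω ⟨bU.repr u, fun i => by rw [hrepr, bU.sum_repr, hu]⟩
    refine bW.repr.injective (Finsupp.ext fun i => ?_)
    have := h5 i
    rwa [hrepr ω fun j => x j ω] at this

end VMem

/-- A family of functions of the inputs which can be computed with `c` operations is the family of
outputs of a program of that cost. -/
theorem Computes.exists_program {ι κ : Type} {c : ℕ} {f : κ → (ι → K) → K}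
    (h : Computes (Set.range fun (i : ι) (a : ι → K) => a i) c (Set.range f)) :
    ∃ D : ArithProgram K ι κ, D.cost ≤ c ∧ ∀ a o, D.eval a o = f o a := by
  classical
  have key : ∀ (I : Set ((ι → K) → K)) d T, Derivable I d T →
      I = (Set.range fun (i : ι) (a : ι → K) => a i) →
      -- Each operation writes to a fresh working register, numbered by its position, so no earlier
      -- value is overwritten.
      ∃ code : List (ArithInstr K (ι ⊕ ℕ)), code.length = d ∧
        ∀ g ∈ T, ∃ ρ : ι ⊕ ℕ, (∀ j, ρ = .inr j → j < d) ∧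
          ∀ a, code.foldl ArithInstr.step (Sum.elim a fun _ => 0) ρ = g a := by
    intro I d T hT hI
    induction hT with
    | base =>
      subst hI
      refine ⟨[], rfl, ?_⟩
      rintro _ ⟨i, rfl⟩
      exact ⟨.inl i, by simp, by simp⟩
    | @step d T g _ hg ih =>
      obtain ⟨code, hlen, hreg⟩ := ih
      have hwrite : ∃ s : ArithInstr K (ι ⊕ ℕ), ∀ (a : ι → K),
          ArithInstr.step (code.foldl ArithInstr.step (Sum.elim a fun _ => 0)) s (.inr d) = g a ∧
          ∀ ρ, ρ ≠ .inr d →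
            ArithInstr.step (code.foldl ArithInstr.step (Sum.elim a fun _ => 0)) s ρ =
              code.foldl ArithInstr.step (Sum.elim a fun _ => 0) ρ := by
        cases hg with
        | const b => exact ⟨.const (.inr d) b, fun a =>
            ⟨by simp [ArithInstr.step], fun ρ h => by simp [ArithInstr.step, h]⟩⟩
        | add h1 h2 =>
          obtain ⟨r1, -, e1⟩ := hreg _ h1
          obtain ⟨r2, -, e2⟩ := hreg _ h2
          exact ⟨.add (.inr d) r1 r2, fun a =>
            ⟨by simp [ArithInstr.step, e1, e2], fun ρ h => by simp [ArithInstr.step, h]⟩⟩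
        | sub h1 h2 =>
          obtain ⟨r1, -, e1⟩ := hreg _ h1
          obtain ⟨r2, -, e2⟩ := hreg _ h2
          exact ⟨.sub (.inr d) r1 r2, fun a =>
            ⟨by simp [ArithInstr.step, e1, e2], fun ρ h => by simp [ArithInstr.step, h]⟩⟩
        | mul h1 h2 =>
          obtain ⟨r1, -, e1⟩ := hreg _ h1
          obtain ⟨r2, -, e2⟩ := hreg _ h2
          exact ⟨.mul (.inr d) r1 r2, fun a =>
            ⟨by simp [ArithInstr.step, e1, e2], fun ρ h => by simp [ArithInstr.step, h]⟩⟩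
        | inv h1 =>
          obtain ⟨r1, -, e1⟩ := hreg _ h1
          exact ⟨.inv (.inr d) r1, fun a =>
            ⟨by simp [ArithInstr.step, e1], fun ρ h => by simp [ArithInstr.step, h]⟩⟩
        | sel h1 h2 h3 =>
          obtain ⟨r1, -, e1⟩ := hreg _ h1
          obtain ⟨r2, -, e2⟩ := hreg _ h2
          obtain ⟨r3, -, e3⟩ := hreg _ h3
          exact ⟨.sel (.inr d) r1 r2 r3, fun a =>
            ⟨by simp [ArithInstr.step, e1, e2, e3], fun ρ h => by simp [ArithInstr.step, h]⟩⟩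
      obtain ⟨s, hs⟩ := hwrite
      refine ⟨code ++ [s], by simp [hlen], ?_⟩
      rintro f (rfl | hf)
      · refine ⟨.inr d, ?_, fun a => ?_⟩
        · rintro j h; cases h; exact Nat.lt_succ_self _
        · rw [List.foldl_append, List.foldl_cons, List.foldl_nil, (hs a).1]
      · obtain ⟨ρ, hρ, e⟩ := hreg f hf
        refine ⟨ρ, fun j hj => (hρ j hj).trans (Nat.lt_succ_self _), fun a => ?_⟩
        rw [List.foldl_append, List.foldl_cons, List.foldl_nil, (hs a).2, e]
        intro h
        exact lt_irrefl _ (hρ d h)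
  obtain ⟨d, hd, T, hT, h⟩ := h
  obtain ⟨code, hlen, hreg⟩ := key _ d T h rfl
  choose out _ hout using fun o => hreg (f o) (hT ⟨o, rfl⟩)
  exact ⟨⟨code, out⟩, hlen.trans_le hd, fun a o => hout o a⟩

end StraightLine

/-! ### Linearized polynomials -/

namespace Linearized

open Module Submodule

variable (F : Type*) [Field F] [Finite F] (L : Type*) [Field L] [Algebra F L]

/-- The `F`-linear map `x ↦ x ^ (|F| ^ j)`. -/
noncomputable def frob (j : ℕ) : L →ₗ[F] L :=
  letI := Fintype.ofFinite F
  ((FiniteField.frobeniusAlgHom F L) ^ j).toLinearMap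

/-- The linearized polynomial `x ↦ ∑ fⱼ x ^ (|F| ^ j)`, as a linear function of its coefficients. -/
noncomputable def linPoly (d : ℕ) : (Fin d → L) →ₗ[L] (L →ₗ[F] L) :=
  Fintype.linearCombination L fun j : Fin d => frob F L j

variable {F L}

theorem frob_apply (j : ℕ) (a : L) : frob F L j a = a ^ (Nat.card F ^ j) := by
  let _ := Fintype.ofFinite F
  rw [Nat.card_eq_fintype_card]
  simp [frob, FiniteField.coe_frobeniusAlgHom, pow_iterate]

theorem frob_mul (j : ℕ) (a b : L) : frob F L j (a * b) = frob F L j a * frob F L j b := by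
  simp only [frob_apply, mul_pow]

theorem frob_frob (i j : ℕ) (a : L) : frob F L i (frob F L j a) = frob F L (j + i) a := by
  simp only [frob_apply, ← pow_mul, ← pow_add]

theorem linPoly_apply {d : ℕ} (f : Fin d → L) (a : L) :
    linPoly F L d f a = ∑ j, f j * frob F L j a := by
  simp [linPoly, Fintype.linearCombination_apply]

theorem frob_mem_range {d j : ℕ} (h : j < d) : frob F L j ∈ LinearMap.range (linPoly F L d) := by
  refine ⟨Pi.single ⟨j, h⟩ 1, ?_⟩
  simp [linPoly, Fintype.linearCombination_apply_single]

theorem frob_comp_mem_range {d j e : ℕ} (h : d + j ≤ e) (f : Fin d → L) :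
    frob F L j ∘ₗ linPoly F L d f ∈ LinearMap.range (linPoly F L e) := by
  have : frob F L j ∘ₗ linPoly F L d f =
      ∑ i : Fin d, frob F L j (f i) • frob F L (i + j) := by
    ext a
    simp [linPoly_apply, frob_mul, frob_frob]
  rw [this]
  exact sum_mem fun i _ => Submodule.smul_mem _ _ (frob_mem_range (by omega))

/-- The monic linearized polynomial of degree `z` with lower coefficients `v`. -/
noncomputable def monic {z : ℕ} (v : Fin z → L) : L →ₗ[F] L := frob F L z + linPoly F L z v

theorem monic_apply {z : ℕ} (v : Fin z → L) (a : L) :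
    monic (F := F) v a = frob F L z a + linPoly F L z v a := rfl

theorem monic_comp_mem_range {z d : ℕ} (v : Fin z → L) (f : Fin d → L) :
    monic (F := F) v ∘ₗ linPoly F L d f ∈ LinearMap.range (linPoly F L (d + z)) := by
  have : monic (F := F) v ∘ₗ linPoly F L d f = frob F L z ∘ₗ linPoly F L d f +
      ∑ j : Fin z, v j • (frob F L j ∘ₗ linPoly F L d f) := by
    ext a
    simp [monic_apply, linPoly_apply (d := z)]
  rw [this]
  exact add_mem (frob_comp_mem_range le_rfl f) (sum_mem fun j _ =>
    Submodule.smul_mem _ _ (frob_comp_mem_range (by omega) f))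

/-- Every family of at most `z` elements is annihilated by a monic linearized polynomial of degree
`z`. -/
theorem exists_monic_eq_zero (z : ℕ) (s : Finset L) (hs : s.card ≤ z) :
    ∃ v : Fin z → L, ∀ a ∈ s, monic (F := F) v a = 0 := by
  classical
  induction z generalizing s with
  | zero =>
    have : s = ∅ := Finset.card_eq_zero.mp (Nat.le_zero.mp hs)
    subst this
    exact ⟨0, by simp⟩
  | succ z ih =>
    -- For an empty family the dummy root `b = 0` keeps the degree exactly `z + 1`.
    obtain ⟨b, t, ht, hst⟩ : ∃ (b : L) (t : Finset L), t.card ≤ z ∧ ∀ a ∈ s, a = b ∨ a ∈ t := by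
      rcases s.eq_empty_or_nonempty with rfl | ⟨b, hb⟩
      · exact ⟨0, ∅, by simp, by simp⟩
      · refine ⟨b, s.erase b, by rw [Finset.card_erase_of_mem hb]; omega, fun a ha => ?_⟩
        by_cases h : a = b
        · exact Or.inl h
        · exact Or.inr (Finset.mem_erase.mpr ⟨h, ha⟩)
    obtain ⟨v, hv⟩ := ih t ht
    let V := monic (F := F) v
    -- With `q = |F|`, the polynomial `V ^ q - κ V` keeps the zeros of `V` and also vanishes at `b`.
    let κ : L := frob F L 1 (V b) / V b
    have hmem : frob F L 1 ∘ₗ linPoly F L z v - κ • V ∈ LinearMap.range (linPoly F L (z + 1)) := by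
      refine sub_mem (frob_comp_mem_range le_rfl v) (Submodule.smul_mem _ _ (add_mem
        (frob_mem_range (Nat.lt_succ_self z)) ?_))
      have := frob_comp_mem_range (F := F) (j := 0) (e := z + 1) (by omega) v
      convert this using 1
      ext a
      simp [frob_apply]
    obtain ⟨v', hv'⟩ := hmem
    have key : ∀ a, monic (F := F) v' a = frob F L 1 (V a) - κ * V a := by
      intro a
      rw [monic_apply, hv']
      simp only [V, LinearMap.sub_apply, LinearMap.comp_apply, LinearMap.smul_apply, smul_eq_mul]
      rw [monic_apply v a, map_add, frob_frob]
      ring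
    refine ⟨v', fun a ha => ?_⟩
    rw [key]
    rcases hst a ha with rfl | h
    · by_cases h0 : V a = 0
      · simp [h0]
      · simp [κ, div_mul_cancel₀ _ h0]
    · have : V a = 0 := hv a h
      simp [this]

variable [FiniteDimensional F L]

/-- As an ordinary polynomial, `f` has degree at most `|F| ^ (d - 1)`, while `W` supplies at least
`|F| ^ d` roots. -/
theorem eq_zero_of_vanish {d : ℕ} {f : Fin d → L} (W : Submodule F L) (hd : d ≤ finrank F W)
    (h : ∀ a ∈ W, linPoly F L d f a = 0) : f = 0 := by
  classical
  rcases Nat.eq_zero_or_pos d with rfl | hd0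
  · exact Subsingleton.elim _ _
  have : Finite L := Module.finite_of_finite F
  have : Fintype W := Fintype.ofFinite W
  have hq : 1 < Nat.card F := Finite.one_lt_card
  let p : Polynomial L := ∑ j : Fin d, Polynomial.C (f j) * Polynomial.X ^ (Nat.card F ^ (j : ℕ))
  have hp : p = 0 := by
    refine Polynomial.eq_zero_of_natDegree_lt_card_of_eval_eq_zero p
      (f := fun a : W => (a : L)) Subtype.val_injective (fun a => ?_) ?_
    · rw [← h a a.2, linPoly_apply, Polynomial.eval_finsetSum]
      simp [frob_apply]
    · have h1 : p.natDegree ≤ Nat.card F ^ (d - 1) := by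
        refine Polynomial.natDegree_sum_le_of_forall_le _ _ fun j _ => ?_
        refine (Polynomial.natDegree_C_mul_X_pow_le _ _).trans ?_
        exact Nat.pow_le_pow_right hq.le (by omega)
      have h2 : Fintype.card W = Nat.card F ^ finrank F W := by
        rw [← Nat.card_eq_fintype_card]
        exact Module.natCard_eq_pow_finrank
      rw [h2]
      exact h1.trans_lt (Nat.pow_lt_pow_right hq (by omega))
  funext i
  have h3 := congrArg (fun r => Polynomial.coeff r (Nat.card F ^ (i : ℕ))) hp
  simp only [p, Polynomial.finsetSum_coeff, Polynomial.coeff_C_mul_X_pow,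
    Polynomial.coeff_zero] at h3
  rw [Finset.sum_eq_single i] at h3
  · simpa using h3
  · intro j _ hj
    rw [if_neg]
    intro he
    exact hj (Fin.ext (Nat.pow_right_injective hq he.symm))
  · simp

/-- By rank-nullity, low rank leaves a kernel of dimension at least `d`. This is the rank distance
of Gabidulin codes. -/
theorem eq_zero_of_finrank_range {d z : ℕ} {f : Fin d → L} (hd : d + z ≤ finrank F L)
    (h : finrank F (LinearMap.range (linPoly F L d f)) ≤ z) : f = 0 := by
  have := LinearMap.finrank_range_add_finrank_ker (linPoly F L d f)
  exact eq_zero_of_vanish (LinearMap.ker (linPoly F L d f)) (by omega) fun a ha => ha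

theorem finrank_ker_monic {z : ℕ} (v : Fin z → L) :
    finrank F (LinearMap.ker (monic (F := F) v)) ≤ z := by
  by_contra! hlt
  have h : (Fin.snoc v 1 : Fin (z + 1) → L) = 0 := by
    refine eq_zero_of_vanish (LinearMap.ker (monic (F := F) v)) hlt fun a ha => ?_
    rw [← LinearMap.mem_ker.mp ha, monic_apply, linPoly_apply, linPoly_apply,
      Fin.sum_univ_castSucc]
    simp [add_comm]
  have := congrFun h (Fin.last z)
  simp at this

theorem eq_zero_of_monic_comp {d z : ℕ} {v : Fin z → L} {f : Fin d → L}
    (hd : d + z ≤ finrank F L) (h : ∀ a, monic (F := F) v (linPoly F L d f a) = 0) : f = 0 := by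
  refine eq_zero_of_finrank_range hd (le_trans (finrank_mono ?_) (finrank_ker_monic (F := F) v))
  rintro _ ⟨a, rfl⟩
  exact h a

end Linearized

/-! ### Decoding Gabidulin codes in the presence of corrupted headers -/

namespace Linearized

open Module Submodule StraightLine

section Gabidulin

variable {F : Type*} [Field F] [Finite F] {L : Type*} [Field L] [Algebra F L] {R N : ℕ}

/-- Codewords are values of linearized polynomials; the change of basis `A` is absorbed into the
coefficients. -/
theorem gabidulin_mulVec (g : Fin N → L) (A : Matrix (Fin R) (Fin R) L) (a : Fin R → L)
    (l : Fin N) :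
    (((Matrix.of fun (i : Fin N) (j : Fin R) => g i ^ (Nat.card F ^ (j : ℕ))) * A).mulVec a) l =
      linPoly F L R (A.mulVec a) (g l) := by
  rw [← Matrix.mulVec_mulVec, linPoly_apply]
  simp only [Matrix.mulVec, dotProduct, Matrix.of_apply, frob_apply]
  exact Finset.sum_congr rfl fun _ _ => mul_comm _ _

theorem mulVec_injective_of_isUnit {A : Matrix (Fin R) (Fin R) L} (hA : IsUnit A) :
    Function.Injective A.mulVec :=
  Matrix.mulVec_injective_iff_isUnit.mpr hA

variable [FiniteDimensional F L]

/-- A functional that kills all rows is a message with zero codeword, that is, a linearized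
polynomial with `R` coefficients vanishing on the `N`-dimensional span of the `g l`. -/
theorem span_rows_gabidulin {G : Matrix (Fin N) (Fin R) L} (hG : IsGabidulinGenerator F G)
    (hRN : R ≤ N) : span L (Set.range fun l => G l) = ⊤ := by
  obtain ⟨g, A, hg, hA, hGA⟩ := hG
  by_contra hne
  obtain ⟨φ, hφ, hle⟩ := Submodule.exists_le_ker_of_lt_top _ (lt_top_iff_ne_top.mpr hne)
  let a : Fin R → L := fun j => φ (Pi.single j 1)
  have hφa : ∀ b : Fin R → L, φ b = ∑ j, b j * a j := by
    intro b
    conv_lhs => rw [← Finset.univ_sum_single b, map_sum]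
    refine Finset.sum_congr rfl fun j _ => ?_
    rw [← smul_eq_mul, ← map_smul, ← Pi.single_smul, smul_eq_mul, mul_one]
  have h1 : ∀ l, linPoly F L R (A.mulVec a) (g l) = 0 := by
    intro l
    rw [← gabidulin_mulVec, ← hGA]
    have : φ (G l) = 0 := hle (subset_span ⟨l, rfl⟩)
    rwa [hφa] at this
  have h2 : A.mulVec a = 0 := by
    refine eq_zero_of_vanish (F := F) (span F (Set.range g)) ?_ fun b hb => ?_
    · rwa [finrank_span_eq_card hg, Fintype.card_fin]
    · have h3 : span F (Set.range g) ≤ LinearMap.ker (linPoly F L R (A.mulVec a)) := by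
        rw [span_le]
        rintro _ ⟨l, rfl⟩
        exact h1 l
      exact h3 hb
  have h3 : a = 0 := mulVec_injective_of_isUnit hA (by rw [h2, Matrix.mulVec_zero])
  refine hφ (LinearMap.ext fun b => ?_)
  rw [hφa, h3]
  simp

end Gabidulin

theorem top_of_linearIndependent {F : Type*} [Field F] {L : Type*} [AddCommGroup L] [Module F L]
    [FiniteDimensional F L] {N : ℕ} {h : Fin N → L} (hh : LinearIndependent F h)
    (hN : finrank F L = N) : span F (Set.range h) = ⊤ :=
  hh.span_eq_top_of_card_eq_finrank' (by simp [hN])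

section Decoder

variable {K : Type*} [Field K] {F : Type*} [Field F] [Finite F] {L : Type*} [Field L]
  [Algebra K F] [Algebra K L] [Algebra F L] [IsScalarTower K F L]
  {Ω : Type*}

/-- Every solution of the key equation yields the product of the annihilating polynomial with the
message polynomial, provided that the transfer matrix is nonsingular. -/
theorem key_equation_unique [FiniteDimensional F L] {R z N R' n' C : ℕ} (hN : N = R + 2 * z)
    (hfin : finrank F L = N) {h : Fin N → L} (hh : LinearIndependent F h)
    (G' : Matrix (Fin n') (Fin R') F) {ι : Type y} [Fintype ι] (hι : Fintype.card ι ≤ z)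
    {T₁ Y₁ : Fin C → Fin n' → K} {T₂ Y : Fin C → Fin N → K} {D : Fin C → ι → K}
    {Z₁ : ι → Fin n' → K} {Z₂ : ι → Fin N → K}
    (hT : span F (Set.range fun i => ((∑ l, T₁ i l • G' l, ∑ l, T₂ i l • Pi.single l (1 : F)) :
      (Fin R' → F) × (Fin N → F))) = ⊤)
    (hY₁ : ∀ i l, Y₁ i l = T₁ i l + ∑ e, D i e * Z₁ e l)
    (hY : ∀ i l, Y i l = T₂ i l + ∑ e, D i e * Z₂ e l)
    {u : Fin R' → L} {f : Fin (R + z) → L} {ζ : ι → L}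
    (heq : ∀ i, ∑ l, Y₁ i l • ∑ j, G' l j • u j + ∑ l, Y i l • linPoly F L (R + z) f (h l) =
      ∑ e, D i e • ζ e) : f = 0 := by
  -- Replacing the corrupted headers by the true transfer matrices only alters the vector that `D`
  -- multiplies.
  let θ : ι → L := fun e => ζ e - ∑ l, Z₁ e l • ∑ j, G' l j • u j -
    ∑ l, Z₂ e l • linPoly F L (R + z) f (h l)
  have h1 : ∀ i, ∑ l, T₁ i l • ∑ j, G' l j • u j + ∑ l, T₂ i l • linPoly F L (R + z) f (h l) =
      ∑ e, D i e • θ e := by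
    intro i
    have h2 := heq i
    simp only [hY₁, hY, add_smul, Finset.sum_add_distrib, Finset.sum_smul] at h2
    simp only [θ, smul_sub, Finset.sum_sub_distrib]
    rw [← h2]
    have e1 : ∑ e, D i e • ∑ l, Z₁ e l • ∑ j, G' l j • u j =
        ∑ l, ∑ e, (D i e * Z₁ e l) • ∑ j, G' l j • u j := by
      rw [Finset.sum_comm]
      simp only [mul_smul, Finset.smul_sum]
    have e2 : ∑ e, D i e • ∑ l, Z₂ e l • linPoly F L (R + z) f (h l) =
        ∑ l, ∑ e, (D i e * Z₂ e l) • linPoly F L (R + z) f (h l) := by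
      rw [Finset.sum_comm]
      simp only [mul_smul, Finset.smul_sum]
    rw [e1, e2]
    abel
  let Λ : (Fin R' → F) × (Fin N → F) →ₗ[F] L :=
    (Fintype.linearCombination F u).coprod
      (Fintype.linearCombination F fun l => linPoly F L (R + z) f (h l))
  let S : Submodule F L := span F (Set.range θ)
  -- The rows of `[T₁ G' | T₂]` span over `F`, so each value `f (h l)` is an `F`-combination of the
  -- right-hand sides and lies in the span of at most `z` elements `θ e`.
  have h3 : (⊤ : Submodule F ((Fin R' → F) × (Fin N → F))) ≤ S.comap Λ := by
    rw [← hT, span_le]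
    rintro _ ⟨i, rfl⟩
    have h4 : Λ (∑ l, T₁ i l • G' l, ∑ l, T₂ i l • Pi.single l (1 : F)) = ∑ e, D i e • θ e := by
      rw [← h1 i]
      simp only [Λ, LinearMap.coprod_apply]
      congr 1
      · simp only [Fintype.linearCombination_apply, Finset.sum_apply, Pi.smul_apply,
          Finset.sum_smul, Finset.smul_sum, smul_assoc]
        exact Finset.sum_comm
      · rw [map_sum]
        refine Finset.sum_congr rfl fun l _ => ?_
        rw [← algebraMap_smul F (T₂ i l), map_smul, Fintype.linearCombination_apply_single,
          one_smul, algebraMap_smul]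
    show Λ _ ∈ S
    rw [h4]
    refine sum_mem fun e _ => ?_
    rw [← algebraMap_smul F]
    exact S.smul_mem _ (subset_span ⟨e, rfl⟩)
  have h5 : ∀ l, linPoly F L (R + z) f (h l) ∈ S := by
    intro l
    have := h3 (x := (0, Pi.single l 1)) trivial
    simpa [Λ, Fintype.linearCombination_apply_single] using this
  have h6 : LinearMap.range (linPoly F L (R + z) f) ≤ S := by
    rw [LinearMap.range_eq_map, ← top_of_linearIndependent hh hfin, map_span, span_le]
    rintro _ ⟨_, ⟨l, rfl⟩, rfl⟩
    exact h5 l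
  have h7 : finrank F S ≤ z := (finrank_range_le_card θ).trans hι
  exact eq_zero_of_finrank_range (z := z) (by omega) ((finrank_mono h6).trans h7)

theorem vMem_monic {d : ℕ} {P : Submodule K (Ω → K)} (h1 : 1 ∈ P) {v : Ω → Fin d → L}
    (hv : VMem P v) (a : L) : VMem P fun ω => Linearized.monic (F := F) (v ω) a := by
  have := (VMem.const h1 (frob F L d a)).add
    (hv.map ((LinearMap.applyₗ (R := F) a).restrictScalars K ∘ₗ
      ((linPoly F L d).restrictScalars K)))
  exact this

/-- The decoder for one symbol over the extension field: the messages are computed from the received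
words by solving two systems of linear equations over the base field. -/
theorem exists_decoder [FiniteDimensional F L] [FiniteDimensional K L] {R z N R' n' C : ℕ}
    (hN : N = R + 2 * z) (hfin : finrank F L = N) {G : Matrix (Fin N) (Fin R) L}
    (hG : IsGabidulinGenerator F G)
    (G' : Matrix (Fin n') (Fin R') F) {I : Set (Ω → K)} {c M : ℕ} {P : Submodule K (Ω → K)}
    (hP : Gen I c M P) (h1 : 1 ∈ P) (hM : 1 ≤ M) (hM₁ : finrank K L * (N + R') ≤ M)
    (hM₂ : finrank K L * C ≤ M) {Y₁ : Ω → Fin C → Fin n' → K} {Y : Ω → Fin C → Fin N → K}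
    {y : Ω → Fin C → L} (hY₁ : ∀ i l, (fun ω => Y₁ ω i l) ∈ P) (hY : ∀ i l, (fun ω => Y ω i l) ∈ P)
    (hy : ∀ i, VMem P fun ω => y ω i) :
    ∃ (x : Ω → Fin R → L) (P' : Submodule K (Ω → K)), P ≤ P' ∧
      Gen I (c + 1000 * M ^ 3) (4 * M) P' ∧ VMem P' x ∧
      ∀ (ω : Ω) (ι : Type y) [Fintype ι], Fintype.card ι ≤ z →
      ∀ (T₁ : Fin C → Fin n' → K) (T₂ : Fin C → Fin N → K) (D : Fin C → ι → K)
        (Z₁ : ι → Fin n' → K) (Z₂ : ι → Fin N → K) (ζ : ι → L) (x₁ : Fin R' → L)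
        (x₂ : Fin R → L),
        span F (Set.range fun i => ((∑ l, T₁ i l • G' l, ∑ l, T₂ i l • Pi.single l (1 : F)) :
          (Fin R' → F) × (Fin N → F))) = ⊤ →
        (∀ i l, Y₁ ω i l = T₁ i l + ∑ e, D i e * Z₁ e l) →
        (∀ i l, Y ω i l = T₂ i l + ∑ e, D i e * Z₂ e l) →
        (∀ i, y ω i = ∑ l, Y₁ ω i l • ∑ j, G' l j • x₁ j + ∑ l, Y ω i l • G.mulVec x₂ l +
          ∑ e, D i e • ζ e) → x ω = x₂ := by
  classical
  obtain ⟨h, A, hh, hA, hGA⟩ := hG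
  have hGx : ∀ a l, G.mulVec a l = linPoly F L R (A.mulVec a) (h l) := by
    intro a l
    rw [hGA, gabidulin_mulVec]
  have hspan := top_of_linearIndependent hh hfin
  -- the key equation
  let A₁ : Ω → ((Fin z → L) × (Fin R' → L) × (Fin (R + z) → L)) →ₗ[K] (Fin C → L) := fun ω =>
    { toFun := fun p i => linPoly F L z p.1 (y ω i) - ∑ l, Y₁ ω i l • ∑ j, G' l j • p.2.1 j -
        ∑ l, Y ω i l • linPoly F L (R + z) p.2.2 (h l)
      map_add' := by
        intro p q
        funext i
        simp only [Prod.fst_add, Prod.snd_add, map_add, LinearMap.add_apply, Pi.add_apply, smul_add,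
          Finset.sum_add_distrib]
        abel
      map_smul' := by
        intro b p
        funext i
        simp only [Prod.smul_fst, Prod.smul_snd, LinearMap.map_smul_of_tower, LinearMap.smul_apply,
          Pi.smul_apply, RingHom.id_apply, smul_sub, Finset.smul_sum]
        congr 1
        · congr 1
          refine Finset.sum_congr rfl fun l _ => Finset.sum_congr rfl fun j _ => ?_
          rw [smul_comm (G' l j) b, smul_comm (Y₁ ω i l) b]
        · exact Finset.sum_congr rfl fun l _ => smul_comm _ _ _ }
  obtain ⟨s, P₁, hPP₁, hP₁, hs, hsol₁⟩ := hP.solve (U := (Fin z → L) × (Fin R' → L) ×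
    (Fin (R + z) → L)) (W := Fin C → L) hM (by
      simp only [finrank_prod, finrank_pi_fintype, Finset.sum_const, Finset.card_univ,
        Fintype.card_fin, smul_eq_mul]
      refine le_trans (le_of_eq ?_) hM₁
      subst hN
      ring) (by
      simp only [finrank_pi_fintype, Finset.sum_const, Finset.card_univ,
        Fintype.card_fin, smul_eq_mul]
      rwa [mul_comm]) (A := A₁) (β := fun ω i => - frob F L z (y ω i)) (fun p => VMem.pi fun i =>
        (((hy i).map ((linPoly F L z p.1).restrictScalars K)).sub
          (VMem.sum fun l _ => VMem.smul_const (hY₁ i l) _)).sub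
          (VMem.sum fun l _ => VMem.smul_const (hY i l) _))
      (VMem.pi fun i => (hy i).map (-((frob F L z).restrictScalars K)))
  have h1' := hPP₁ h1
  have hs₁ : VMem P₁ fun ω => (s ω).1 := hs.map (LinearMap.fst K _ _)
  have hs₂ : VMem P₁ fun ω => (s ω).2.2 :=
    hs.map (LinearMap.snd K _ _ ∘ₗ LinearMap.snd K _ _)
  -- division of linearized polynomials
  let A₂ : Ω → (Fin R → L) →ₗ[K] (Fin N → L) := fun ω =>
    LinearMap.pi fun l => ((monic (F := F) (s ω).1).restrictScalars K) ∘ₗ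
      (LinearMap.proj l ∘ₗ (Matrix.mulVecLin G).restrictScalars K)
  have hA₂ : ∀ ω a l, A₂ ω a l = monic (F := F) (s ω).1 (G.mulVec a l) := fun ω a l => rfl
  have hN1 : finrank K L * N ≤ M := (Nat.mul_le_mul_left _ (Nat.le_add_right _ _)).trans hM₁
  obtain ⟨x, P₂, hPP₂, hP₂, hx, hsol₂⟩ := hP₁.solve (U := Fin R → L) (W := Fin N → L)
    (by omega) (by
      simp only [finrank_pi_fintype, Finset.sum_const, Finset.card_univ,
        Fintype.card_fin, smul_eq_mul]
      have : R * finrank K L ≤ finrank K L * N := by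
        rw [mul_comm]
        exact Nat.mul_le_mul_left _ (by omega)
      omega) (by
      simp only [finrank_pi_fintype, Finset.sum_const, Finset.card_univ,
        Fintype.card_fin, smul_eq_mul]
      rw [mul_comm]
      omega) (A := A₂) (β := fun ω l => linPoly F L (R + z) (s ω).2.2 (h l))
      (fun a => VMem.pi fun l => vMem_monic h1' hs₁ _)
      (VMem.pi fun l => hs₂.map ((LinearMap.applyₗ (R := F) (h l)).restrictScalars K ∘ₗ
        ((linPoly F L (R + z)).restrictScalars K)))
  refine ⟨x, P₂, hPP₁.trans hPP₂, hP₂.mono ?_ (by omega) le_rfl, hx, ?_⟩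
  -- The two systems cost `100 * M ^ 3` and `100 * (2 * M) ^ 3`.
  · rw [mul_pow]
    omega
  intro ω ι _ hι T₁ T₂ D Z₁ Z₂ ζ x₁ x₂ hT hYT₁ hYT hyT
  have hVy : ∀ (v : Fin z → L) i, monic (F := F) v (y ω i) =
      ∑ l, Y₁ ω i l • ∑ j, G' l j • monic (F := F) v (x₁ j) +
        ∑ l, Y ω i l • monic (F := F) v (linPoly F L R (A.mulVec x₂) (h l)) +
          ∑ e, D i e • monic (F := F) v (ζ e) := by
    intro v i
    rw [hyT i]
    simp only [map_add, map_sum, LinearMap.map_smul_of_tower, map_smul, hGx]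
  have hcoef : ∀ v : Fin z → L, ∃ f : Fin (R + z) → L, ∀ a, linPoly F L (R + z) f a =
      monic (F := F) v (linPoly F L R (A.mulVec x₂) a) := by
    intro v
    obtain ⟨f, hf⟩ := monic_comp_mem_range (F := F) v (A.mulVec x₂)
    exact ⟨f, fun a => by rw [hf]; rfl⟩
  -- The key equation is solvable: a monic `V` that kills all `ζ e` gives a solution.
  have e₁ : A₁ ω (s ω) = fun i => - frob F L z (y ω i) := by
    refine hsol₁ ω ?_
    obtain ⟨v, hv⟩ := exists_monic_eq_zero (F := F) z (Finset.univ.image ζ)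
      (Finset.card_image_le.trans hι)
    obtain ⟨f, hf⟩ := hcoef v
    refine ⟨(v, fun j => monic (F := F) v (x₁ j), f), ?_⟩
    funext i
    have h2 := hVy v i
    have h3 : ∑ e, D i e • monic (F := F) v (ζ e) = 0 :=
      Finset.sum_eq_zero fun e _ => by rw [hv (ζ e) (by simp), smul_zero]
    rw [h3, add_zero, monic_apply] at h2
    show linPoly F L z v (y ω i) - ∑ l, Y₁ ω i l • ∑ j, G' l j • monic (F := F) v (x₁ j) -
      ∑ l, Y ω i l • linPoly F L (R + z) f (h l) = _
    simp only [hf]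
    rw [eq_neg_iff_add_eq_zero, sub_sub, ← h2]
    abel
  obtain ⟨f, hf⟩ := hcoef (s ω).1
  -- The `V` that was found may differ from the witness and need not kill the errors. Its values on
  -- them are absorbed in the error vector of `key_equation_unique`, which determines `f` but not
  -- the component for `u`.
  have e₂ : (s ω).2.2 = f := by
    rw [← sub_eq_zero]
    refine key_equation_unique (F := F) hN hfin hh G' hι hT hYT₁ hYT
      (u := fun j => (s ω).2.1 j - monic (F := F) (s ω).1 (x₁ j))
      (ζ := fun e => monic (F := F) (s ω).1 (ζ e)) fun i => ?_
    have h2 := congrFun e₁ i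
    have h3 := hVy (s ω).1 i
    change linPoly F L z (s ω).1 (y ω i) - ∑ l, Y₁ ω i l • ∑ j, G' l j • (s ω).2.1 j -
      ∑ l, Y ω i l • linPoly F L (R + z) (s ω).2.2 (h l) = - frob F L z (y ω i) at h2
    rw [monic_apply] at h3
    simp only [← hf] at h3
    simp only [smul_sub, Finset.sum_sub_distrib, map_sub, LinearMap.sub_apply]
    linear_combination h3 - h2
  have e₃ : A₂ ω (x ω) = fun l => linPoly F L (R + z) (s ω).2.2 (h l) := by
    refine hsol₂ ω ⟨x₂, ?_⟩
    funext l
    rw [hA₂, e₂, hf, hGx]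
  -- Left division by the monic `V` is unique: a product that vanishes on the basis `h` vanishes on
  -- `L`, so the other factor maps into the kernel of `V`, of dimension at most `z`.
  have e₄ : A.mulVec (x ω - x₂) = 0 := by
    refine eq_zero_of_monic_comp (F := F) (v := (s ω).1) (z := z) (by omega) fun a => ?_
    have h4 : span F (Set.range h) ≤
        LinearMap.ker (monic (F := F) (s ω).1 ∘ₗ linPoly F L R (A.mulVec (x ω - x₂))) := by
      rw [span_le]
      rintro _ ⟨l, rfl⟩
      have h5 := congrFun e₃ l
      rw [hA₂, e₂, hf, hGx] at h5
      show monic (F := F) (s ω).1 (linPoly F L R (A.mulVec (x ω - x₂)) (h l)) = 0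
      rw [Matrix.mulVec_sub, map_sub, LinearMap.sub_apply, map_sub, h5, sub_self]
    rw [hspan] at h4
    exact h4 trivial
  exact sub_eq_zero.mp (mulVec_injective_of_isUnit hA (by rw [e₄, Matrix.mulVec_zero]))

end Decoder

end Linearized

/-! ### Successive decoding of the two sources -/

namespace Linearized

open Module Submodule StraightLine

section TwoStage

variable {K : Type*} [Field K] [Finite K] {F : Type*} [Field F] [Finite F] {L : Type*} [Field L]
  [Algebra K F] [Algebra K L] [Algebra F L] [IsScalarTower K F L]
  [FiniteDimensional K F] [FiniteDimensional F L] [FiniteDimensional K L] {Ω : Type*}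

/-- The decoder for one symbol over the larger extension: first the message of the second source is
decoded over `L / F`, then the coordinates of the message of the first source over `F / K`. -/
theorem exists_two_stage_decoder {R₁ R₂ z n N C : ℕ} (hn : n = R₁ + 2 * z) (hN : N = R₂ + 2 * z)
    (hKF : finrank K F = n) (b₂ : Basis (Fin N) F L)
    {G₁ : Matrix (Fin n) (Fin R₁) F} {G₂ : Matrix (Fin N) (Fin R₂) L}
    (hG₁ : IsGabidulinGenerator K G₁) (hG₂ : IsGabidulinGenerator F G₂)
    {I : Set (Ω → K)} {c M : ℕ} {P : Submodule K (Ω → K)}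
    (hP : Gen I c M P) (h1 : 1 ∈ P) (hM : 1 ≤ M) (hM₁ : n * N * (N + R₁) ≤ M)
    (hM₂ : n * N * C ≤ M) (hM₃ : n * n ≤ M) (hM₄ : n * C ≤ M)
    {Y₁ : Ω → Fin C → Fin n → K} {Y₂ : Ω → Fin C → Fin N → K}
    {y : Ω → Fin C → L} (hY₁ : ∀ i l, (fun ω => Y₁ ω i l) ∈ P)
    (hY₂ : ∀ i l, (fun ω => Y₂ ω i l) ∈ P) (hy : ∀ i, VMem P fun ω => y ω i) :
    ∃ (x₁ : Fin N → Ω → Fin R₁ → F) (x₂ : Ω → Fin R₂ → L) (Q : Submodule K (Ω → K)),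
      Gen I (N * (c + 1000 * M ^ 3 + 4 * M * (4 * M) + 1000 * (4 * M + 4 * M * (4 * M)) ^ 3))
        (N * (4 * (4 * M + 4 * M * (4 * M)))) Q ∧
      (∀ a, VMem Q (x₁ a)) ∧ VMem Q x₂ ∧
      ∀ (ω : Ω) (ι : Type y) [Fintype ι], Fintype.card ι ≤ z →
      ∀ (T₁ : Fin C → Fin n → K) (T₂ : Fin C → Fin N → K) (D : Fin C → ι → K)
        (Z₁ : ι → Fin n → K) (Z₂ : ι → Fin N → K) (ζ : ι → L) (m₁ : Fin R₁ → L)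
        (m₂ : Fin R₂ → L),
        span F (Set.range fun i => ((∑ l, T₁ i l • G₁ l, ∑ l, T₂ i l • Pi.single l (1 : F)) :
          (Fin R₁ → F) × (Fin N → F))) = ⊤ →
        span K (Set.range T₁) = ⊤ →
        (∀ i l, Y₁ ω i l = T₁ i l + ∑ e, D i e * Z₁ e l) →
        (∀ i l, Y₂ ω i l = T₂ i l + ∑ e, D i e * Z₂ e l) →
        (∀ i, y ω i = ∑ l, Y₁ ω i l • ∑ j, G₁ l j • m₁ j + ∑ l, Y₂ ω i l • G₂.mulVec m₂ l +
          ∑ e, D i e • ζ e) →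
        (∀ a j, x₁ a ω j = b₂.repr (m₁ j) a) ∧ x₂ ω = m₂ := by
  have hFL : finrank F L = N := by simpa using finrank_eq_card_basis b₂
  have hKL : finrank K L = n * N := by rw [← finrank_mul_finrank K F L, hKF, hFL]
  obtain ⟨x₂, P₁, hPP₁, hP₁, hx₂, hdec₂⟩ := exists_decoder.{y} (K := K) hN hFL hG₂ G₁ hP h1 hM
    (by rwa [hKL]) (by rwa [hKL]) hY₁ hY₂ hy
  have hP₂ := hP₁.mul
  set P₂ := P₁ ⊔ P₁ * P₁ 
  have hPP₂ : P ≤ P₂ := hPP₁.trans le_sup_left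
  have hy' : ∀ (a : Fin N) i, VMem P₂ fun ω =>
      b₂.repr (y ω i - ∑ l, Y₂ ω i l • G₂.mulVec (x₂ ω) l) a := by
    intro a i
    refine VMem.map (((hy i).mono hPP₂).sub (VMem.sum fun l _ => ?_))
      ((b₂.coord a).restrictScalars K)
    exact (VMem.smul (hPP₁ (hY₂ i l)) (hx₂.map (LinearMap.proj l ∘ₗ
      (Matrix.mulVecLin G₂).restrictScalars K))).mono le_sup_right
  have hM' : M ≤ 4 * M + 4 * M * (4 * M) := by nlinarith
  -- With the second source subtracted, every coordinate over `F` is a single-source problem over `F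
  -- / K`: the same decoder with the interfering source empty (`R' = n' = 0`).
  have hstage : ∀ a : Fin N, _ := fun a =>
    exists_decoder.{y} (K := K) (F := K) (L := F) (R' := 0) (n' := 0) hn hKF hG₁
      (Matrix.of fun i _ => i.elim0) hP₂ (hPP₂ h1) (hM.trans hM')
      (by rw [hKF, add_zero]; exact hM₃.trans hM') (by rw [hKF]; exact hM₄.trans hM')
      (Y₁ := fun _ _ l => l.elim0) (Y := Y₁)
      (y := fun ω i => b₂.repr (y ω i - ∑ l, Y₂ ω i l • G₂.mulVec (x₂ ω) l) a)
      (fun _ l => l.elim0) (fun i l => hPP₂ (hY₁ i l)) (hy' a)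
  choose x₁ Q hPQ hQ hx₁ hdec₁ using hstage
  have hN0 : 0 < N := hFL ▸ finrank_pos
  refine ⟨x₁, x₂, ⨆ a, Q a, by simpa using Gen.iSup hQ, fun a => (hx₁ a).mono (le_iSup Q a),
    hx₂.mono ((le_sup_left.trans (hPQ ⟨0, hN0⟩)).trans (le_iSup Q _)), ?_⟩
  intro ω ι _ hι T₁ T₂ D Z₁ Z₂ ζ m₁ m₂ hT hT₁ hYT₁ hYT₂ hyT
  have e₂ : x₂ ω = m₂ := hdec₂ ω ι hι T₁ T₂ D Z₁ Z₂ ζ m₁ m₂ hT hYT₁ hYT₂ hyT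
  refine ⟨fun a j => ?_, e₂⟩
  refine congrFun (hdec₁ a ω ι hι (fun _ l => l.elim0) T₁ D (fun _ l => l.elim0) Z₁
    (fun e => b₂.repr (ζ e) a) Fin.elim0 (fun j => b₂.repr (m₁ j) a) ?_ (fun _ l => l.elim0)
    hYT₁ fun i => ?_) j
  -- The factor `Fin 0 → K` is trivial, so the spanning condition reduces to that on the rows of
  -- `T₁`.
  · rw [eq_top_iff]
    rintro ⟨p, q⟩ -
    have hq : q ∈ span K (Set.range T₁) := hT₁ ▸ trivial
    have h2 := mem_map_of_mem (f := LinearMap.inr K (Fin 0 → K) (Fin n → K)) hq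
    rw [map_span, ← Set.range_comp] at h2
    have h3 : LinearMap.inr K (Fin 0 → K) (Fin n → K) q = (p, q) := by
      ext j
      · exact j.elim0
      · rfl
    rw [h3] at h2
    convert h2 using 3
    funext i
    refine Prod.ext (Subsingleton.elim _ _) ?_
    funext l
    simp [Finset.sum_apply, Pi.single_apply]
  · have h5 : ∀ (b : K) (m : L), b₂.repr (b • m) a = b • b₂.repr m a := by
      intro b m
      exact ((b₂.coord a).restrictScalars K).map_smul b m
    rw [hyT i, e₂, add_sub_right_comm, add_sub_cancel_right]
    simp only [map_add, map_sum, Finsupp.add_apply, Finsupp.finsetSum_apply, h5]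
    simp
    rfl

end TwoStage

end Linearized

/-! ### Folding a payload position into one symbol of the large field -/

section Main

open Module Submodule StraightLine Linearized

variable {K : Type u} [Field K] {F : Type v} [Field F] [Algebra K F] {L : Type w} [Field L]
  [Algebra F L] [Algebra K L] {n N k : ℕ}

/-- The symbol of the extension field `L` at the position `κ` of the payload of a packet. -/
noncomputable def foldPacket (b₁ : Basis (Fin n) K F) (b₂ : Basis (Fin N) F L) (κ : Fin k) :
    (PacketIdx n N k → K) →ₗ[K] L :=
  ∑ a : Fin N, ∑ t : Fin n,
    (LinearMap.proj (.inr (.inr ((κ, a), t))) : (PacketIdx n N k → K) →ₗ[K] K).smulRight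
      (b₁ t • b₂ a)

theorem foldPacket_apply (b₁ : Basis (Fin n) K F) (b₂ : Basis (Fin N) F L) (κ : Fin k)
    (p : PacketIdx n N k → K) :
    foldPacket b₁ b₂ κ p = ∑ a, ∑ t, p (.inr (.inr ((κ, a), t))) • b₁ t • b₂ a := by
  simp [foldPacket]

/-- Seen in `L`, the first source still sends combinations with coefficients in `F`. Linearized
polynomials over `F` commute with these, so the first stage can carry its message along as an
unknown. -/
theorem foldPacket_sent₁ [IsScalarTower K F L] {R : ℕ} (b₁ : Basis (Fin n) K F)
    (b₂ : Basis (Fin N) F L) (κ : Fin k)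
    (G₁ : Matrix (Fin n) (Fin R) F) (X₁ : Matrix (Fin R) (Fin k × Fin N) F) (l : Fin n) :
    foldPacket b₁ b₂ κ (fun j => sent₁ b₁ G₁ X₁ l j) =
      ∑ j, G₁ l j • ∑ a, X₁ j (κ, a) • b₂ a := by
  rw [foldPacket_apply]
  have h : ∀ a, ∑ t, sent₁ b₁ G₁ X₁ l (.inr (.inr ((κ, a), t))) • b₁ t • b₂ a =
      (G₁ * X₁) l (κ, a) • b₂ a := by
    intro a
    conv_rhs => rw [← b₁.sum_repr ((G₁ * X₁) l (κ, a)), Finset.sum_smul]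
    exact Finset.sum_congr rfl fun t _ => (smul_assoc _ _ _).symm
  simp only [h, Matrix.mul_apply, Finset.sum_smul, Finset.smul_sum]
  rw [Finset.sum_comm]
  exact Finset.sum_congr rfl fun _ _ => Finset.sum_congr rfl fun _ _ => mul_smul _ _ _

theorem foldPacket_sent₂ [IsScalarTower K F L] {R : ℕ} (b₁ : Basis (Fin n) K F)
    (b₂ : Basis (Fin N) F L) (κ : Fin k)
    (G₂ : Matrix (Fin N) (Fin R) L) (X₂ : Matrix (Fin R) (Fin k) L) (l : Fin N) :
    foldPacket b₁ b₂ κ (fun j => sent₂ b₁ b₂ G₂ X₂ l j) = G₂.mulVec (fun j => X₂ j κ) l := by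
  rw [foldPacket_apply]
  have h : ∀ a, ∑ t, sent₂ b₁ b₂ G₂ X₂ l (.inr (.inr ((κ, a), t))) • b₁ t • b₂ a =
      b₂.repr ((G₂ * X₂) l κ) a • b₂ a := by
    intro a
    conv_rhs => rw [← b₁.sum_repr (b₂.repr ((G₂ * X₂) l κ) a), Finset.sum_smul]
    exact Finset.sum_congr rfl fun t _ => (smul_assoc _ _ _).symm
  simp only [h]
  rw [b₂.sum_repr]
  rfl

end Main

/-! ### Cost, probability and assembly of the decoder -/

section Main

open Module Submodule StraightLine Linearized

/-- The span of the constants, of the headers and of the payload at the position `κ` is generated by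
few inputs. -/
theorem gen_inputs {K : Type u} [Field K] {C n N k : ℕ} (κ : Fin k) :
    ∃ P : Submodule K ((Fin C × PacketIdx n N k → K) → K),
      Gen (Set.range fun (i : Fin C × PacketIdx n N k) (a : Fin C × PacketIdx n N k → K) => a i)
        1 (1 + C * (n + (N + N * n))) P ∧ 1 ∈ P ∧
      (∀ i l, (fun a => a (i, .inl l)) ∈ P) ∧ (∀ i l, (fun a => a (i, .inr (.inl l))) ∈ P) ∧
      ∀ i b t, (fun a => a (i, .inr (.inr ((κ, b), t)))) ∈ P := by
  classical
  let f : Fin C × (Fin n ⊕ (Fin N ⊕ (Fin N × Fin n))) → (Fin C × PacketIdx n N k → K) → K :=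
    fun p a => a (p.1, p.2.map id (Sum.map id fun q => ((κ, q.1), q.2)))
  let t : Finset ((Fin C × PacketIdx n N k → K) → K) := insert 1 (Finset.univ.image f)
  refine ⟨span K (t : Set _), ⟨t, ?_, ?_, le_rfl⟩, subset_span (by simp [t]), fun i l => ?_,
    fun i l => ?_, fun i b s => ?_⟩
  · refine (Finset.card_insert_le _ _).trans ?_
    have : (Finset.univ.image f).card ≤ C * (n + (N + N * n)) :=
      Finset.card_image_le.trans (by simp)
    omega
  · refine ((Computes.one (.const 1)).union (Computes.of_subset (c := 0) subset_rfl)).mono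
      le_rfl ?_
    simp only [t, Finset.coe_insert, Finset.coe_image, Finset.coe_univ, Set.image_univ]
    rintro g (rfl | ⟨p, rfl⟩)
    · exact Or.inl rfl
    · exact Or.inr ⟨_, rfl⟩
  · exact subset_span (Finset.mem_insert_of_mem (Finset.mem_image.mpr
      ⟨(i, .inl l), Finset.mem_univ _, rfl⟩))
  · exact subset_span (Finset.mem_insert_of_mem (Finset.mem_image.mpr
      ⟨(i, .inr (.inl l)), Finset.mem_univ _, rfl⟩))
  · exact subset_span (Finset.mem_insert_of_mem (Finset.mem_image.mpr
      ⟨(i, .inr (.inr (b, s))), Finset.mem_univ _, rfl⟩))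

/-- The dominant term is the second stage: systems of size `O(M ^ 2) = O(C ^ 6)` cost `O(C ^ 18)`
each, and there are `N ≤ C` of them per payload position. -/
theorem decoder_cost_le {n N k R₁ R₂ C M : ℕ} (hn : 1 ≤ n) (hN : 1 ≤ N) (hC : 1 ≤ C) (hnC : n ≤ C)
    (hNC : N ≤ C) (hR : R₁ + R₂ ≤ C) (hM : M = 4 * C ^ 3) :
    k * (N * (1 + 1000 * M ^ 3 + 4 * M * (4 * M) + 1000 * (4 * M + 4 * M * (4 * M)) ^ 3) +
        (R₁ + R₂) * (N * n) * (3 * (N * (4 * (4 * M + 4 * M * (4 * M)))) + 1)) ≤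
      40000000000 * (k * n * N) * C ^ 19 := by
  have hpow : ∀ {a b : ℕ}, a ≤ b → C ^ a ≤ C ^ b := fun h => Nat.pow_le_pow_right hC h
  have h1 : 4 * M + 4 * M * (4 * M) ≤ 272 * C ^ 6 := by
    have := hpow (show 3 ≤ 6 by norm_num)
    rw [hM]
    ring_nf
    omega
  have h2 : (4 * M + 4 * M * (4 * M)) ^ 3 ≤ 20123648 * C ^ 18 := by
    refine (Nat.pow_le_pow_left h1 3).trans (le_of_eq ?_)
    ring
  have h3 : 1 + 1000 * M ^ 3 + 4 * M * (4 * M) + 1000 * (4 * M + 4 * M * (4 * M)) ^ 3 ≤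
      30000000000 * C ^ 18 := by
    have e1 := hpow (show 0 ≤ 18 by norm_num)
    have e2 := hpow (show 9 ≤ 18 by norm_num)
    have e3 := hpow (show 6 ≤ 18 by norm_num)
    have e4 : M ^ 3 = 64 * C ^ 9 := by rw [hM]; ring
    have e5 : 4 * M * (4 * M) = 256 * C ^ 6 := by rw [hM]; ring
    rw [e4, e5]
    rw [pow_zero] at e1
    rw [e5] at h2
    omega
  have h4 : N * (1 + 1000 * M ^ 3 + 4 * M * (4 * M) + 1000 * (4 * M + 4 * M * (4 * M)) ^ 3) ≤
      30000000000 * C ^ 19 := by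
    refine (Nat.mul_le_mul hNC h3).trans (le_of_eq ?_)
    ring
  have h5 : 3 * (N * (4 * (4 * M + 4 * M * (4 * M)))) + 1 ≤ 3265 * C ^ 7 := by
    have e1 : N * (4 * M + 4 * M * (4 * M)) ≤ C * (272 * C ^ 6) := Nat.mul_le_mul hNC h1
    have e2 : C * (272 * C ^ 6) = 272 * C ^ 7 := by ring
    have e3 := hpow (show 0 ≤ 7 by norm_num)
    rw [pow_zero] at e3
    have e4 : N * (4 * (4 * M + 4 * M * (4 * M))) = 4 * (N * (4 * M + 4 * M * (4 * M))) := by ring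
    omega
  have h6 : (R₁ + R₂) * (N * n) * (3 * (N * (4 * (4 * M + 4 * M * (4 * M)))) + 1) ≤
      3265 * C ^ 19 := by
    refine (Nat.mul_le_mul (Nat.mul_le_mul hR (Nat.mul_le_mul hNC hnC)) h5).trans ?_
    calc C * (C * C) * (3265 * C ^ 7) = 3265 * C ^ 10 := by ring
      _ ≤ 3265 * C ^ 19 := Nat.mul_le_mul_left _ (hpow (by norm_num))
  have h7 : k * 1 ≤ k * (n * N) := Nat.mul_le_mul_left k (Nat.mul_pos hn hN)
  calc _ ≤ k * (40000000000 * C ^ 19) := Nat.mul_le_mul_left k (by omega)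
    _ ≤ k * (n * N) * (40000000000 * C ^ 19) := Nat.mul_le_mul_right _ (by omega)
    _ = _ := by ring

theorem uniformProb_ge {Ω : Type*} [Finite Ω] [Nonempty Ω] {A B₁ B₂ : Set Ω} {p e : ℕ} (hp : 0 < p)
    (h₁ : B₁.ncard * p ≤ e * Nat.card Ω) (h₂ : B₂.ncard * p ≤ e * Nat.card Ω)
    (hA : ∀ c, c ∉ B₁ → c ∉ B₂ → c ∈ A) : 1 - 2 * (e : ℝ) / (p : ℝ) ≤ uniformProb A := by
  have hΩ : (0 : ℝ) < Nat.card Ω := by exact_mod_cast Nat.card_pos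
  have hp' : (0 : ℝ) < p := by exact_mod_cast hp
  have h3 : Nat.card Ω ≤ A.ncard + (B₁.ncard + B₂.ncard) := by
    rw [← Set.ncard_univ]
    refine (Set.ncard_le_ncard (t := A ∪ (B₁ ∪ B₂)) ?_).trans
      ((Set.ncard_union_le _ _).trans (Nat.add_le_add_left (Set.ncard_union_le _ _) _))
    intro c _
    by_cases hc₁ : c ∈ B₁
    · exact Or.inr (Or.inl hc₁)
    by_cases hc₂ : c ∈ B₂
    · exact Or.inr (Or.inr hc₂)
    exact Or.inl (hA c hc₁ hc₂)
  have h1' : (B₁.ncard : ℝ) * p ≤ e * Nat.card Ω := by exact_mod_cast h₁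
  have h2' : (B₂.ncard : ℝ) * p ≤ e * Nat.card Ω := by exact_mod_cast h₂
  have h3' : (Nat.card Ω : ℝ) ≤ A.ncard + (B₁.ncard + B₂.ncard) := by exact_mod_cast h3
  rw [uniformProb, le_div_iff₀ hΩ, sub_mul, sub_le_iff_le_add, one_mul, div_mul_eq_mul_div,
    ← sub_le_iff_le_add', le_div_iff₀ hp']
  nlinarith

theorem span_range_single {F : Type*} [Field F] (n : ℕ) :
    span F (Set.range fun l : Fin n => (Pi.single l (1 : F) : Fin n → F)) = ⊤ := by
  have := (Pi.basisFun F (Fin n)).span_eq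
  convert this using 3
  funext l
  simp

/-- The errors in the headers are moved to the error in the payload. -/
theorem sum_smul_eq_of_headers {K L ι₁ ι₂ ι : Type*} [Field K] [AddCommGroup L] [Module K L]
    [Fintype ι₁] [Fintype ι₂] [Fintype ι] {T₁ Y₁ : ι₁ → K} {T₂ Y₂ : ι₂ → K} {D : ι → K}
    {Z₁ : ι → ι₁ → K} {Z₂ : ι → ι₂ → K} {a : ι₁ → L} {b : ι₂ → L} {p : ι → L} {y : L}
    (h₁ : ∀ l, Y₁ l = T₁ l + ∑ e, D e * Z₁ e l) (h₂ : ∀ l, Y₂ l = T₂ l + ∑ e, D e * Z₂ e l)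
    (hy : y = ∑ l, T₁ l • a l + ∑ l, T₂ l • b l + ∑ e, D e • p e) :
    y = ∑ l, Y₁ l • a l + ∑ l, Y₂ l • b l +
      ∑ e, D e • (p e - ∑ l, Z₁ e l • a l - ∑ l, Z₂ e l • b l) := by
  have e₁ : ∑ e, D e • ∑ l, Z₁ e l • a l = ∑ l, ∑ e, (D e * Z₁ e l) • a l := by
    rw [Finset.sum_comm]
    simp only [mul_smul, Finset.smul_sum]
  have e₂ : ∑ e, D e • ∑ l, Z₂ e l • b l = ∑ l, ∑ e, (D e * Z₂ e l) • b l := by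
    rw [Finset.sum_comm]
    simp only [mul_smul, Finset.smul_sum]
  simp only [h₁, h₂, add_smul, Finset.sum_add_distrib, Finset.sum_smul, smul_sub,
    Finset.sum_sub_distrib, e₁, e₂, hy]
  abel

/-- A decoder for all linear channels with nonsingular transfer matrices and at most `z` errors. -/
theorem exists_channel_decoder {K : Type u} [Field K] [Finite K] {F : Type v} [Field F]
    [Algebra K F] {L : Type w} [Field L] [Algebra F L] [Algebra K L] [IsScalarTower K F L]
    {R₁ R₂ z k n N C : ℕ} (hn : n = R₁ + 2 * z) (hN : N = R₂ + 2 * z) (hC : C = R₁ + R₂ + 2 * z)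
    (b₁ : Basis (Fin n) K F) (b₂ : Basis (Fin N) F L) {G₁ : Matrix (Fin n) (Fin R₁) F}
    {G₂ : Matrix (Fin N) (Fin R₂) L} (hG₁ : IsGabidulinGenerator K G₁)
    (hG₂ : IsGabidulinGenerator F G₂) :
    ∃ D : ArithProgram K (Fin C × PacketIdx n N k)
        ((Fin R₁ ⊕ Fin R₂) × ((Fin k × Fin N) × Fin n)),
      D.cost ≤ 40000000000 * (k * n * N) * C ^ 19 ∧
      ∀ (ω : Fin C × PacketIdx n N k → K) (ι : Type y) [Fintype ι], Fintype.card ι ≤ z →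
      ∀ (T₁ : Fin C → Fin n → K) (T₂ : Fin C → Fin N → K) (T₃ : Fin C → ι → K)
        (X₁ : Matrix (Fin R₁) (Fin k × Fin N) F) (X₂ : Matrix (Fin R₂) (Fin k) L)
        (p : ι → PacketIdx n N k → K),
        span F (Set.range fun i => ((∑ l, T₁ i l • G₁ l, ∑ l, T₂ i l • Pi.single l (1 : F)) :
          (Fin R₁ → F) × (Fin N → F))) = ⊤ →
        span K (Set.range T₁) = ⊤ →
        (∀ i, (fun j => ω (i, j)) = ∑ l, T₁ i l • (fun j => sent₁ b₁ G₁ X₁ l j) +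
          ∑ l, T₂ i l • (fun j => sent₂ b₁ b₂ G₂ X₂ l j) + ∑ e, T₃ i e • p e) →
        ∀ o, D.eval ω o =
          Matrix.fromRows (unfoldMat b₁ X₁) (unfoldMat b₁ (unfoldMat b₂ X₂)) o.1 o.2 := by
  classical
  have : FiniteDimensional K F := Module.Finite.of_basis b₁
  have : FiniteDimensional F L := Module.Finite.of_basis b₂
  have : FiniteDimensional K L := Module.Finite.trans F L
  have : Finite F := Module.finite_of_finite K
  have hKF : finrank K F = n := by simpa using finrank_eq_card_basis b₁
  have hFL : finrank F L = N := by simpa using finrank_eq_card_basis b₂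
  have hn1 : 1 ≤ n := hKF ▸ finrank_pos
  have hN1 : 1 ≤ N := hFL ▸ finrank_pos
  have hnC : n ≤ C := by omega
  have hNC : N ≤ C := by omega
  have hC1 : 1 ≤ C := by omega
  choose P hP h1 hP₁ hP₂ hP₃ using fun κ : Fin k =>
    gen_inputs (K := K) (C := C) (n := n) (N := N) κ
  have hM : 1 + C * (n + (N + N * n)) ≤ 4 * C ^ 3 := by
    have e1 : N * n ≤ C * C := Nat.mul_le_mul hNC hnC
    have e2 : C * 1 ≤ C * C := Nat.mul_le_mul_left _ hC1
    have e3 : C * (n + (N + N * n)) ≤ C * (3 * (C * C)) := Nat.mul_le_mul_left _ (by omega)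
    have e4 : 1 ≤ C ^ 3 := Nat.one_le_pow _ _ hC1
    have e5 : C * (3 * (C * C)) = 3 * C ^ 3 := by ring
    omega
  have e1 : n * N * C ≤ 4 * C ^ 3 := by
    calc n * N * C ≤ C * C * C := Nat.mul_le_mul_right _ (Nat.mul_le_mul hnC hNC)
      _ = 1 * C ^ 3 := by ring
      _ ≤ 4 * C ^ 3 := Nat.mul_le_mul_right _ (by norm_num)
  have e2 : n * C ≤ n * N * C := by
    rw [mul_assoc]
    exact Nat.mul_le_mul_left _ (by simpa using Nat.mul_le_mul_right C hN1)
  -- Each position uses only the headers and its own symbols, so `M = 4 * C ^ 3` does not depend on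
  -- `k` and the total cost is linear in `k`.
  have hκ : ∀ κ : Fin k, _ := fun κ =>
    exists_two_stage_decoder.{y} (K := K) hn hN hKF b₂ hG₁ hG₂ ((hP κ).mono le_rfl hM le_rfl)
      (h1 κ) ((Nat.le_add_right _ _).trans hM)
      (by rwa [show N + R₁ = C by omega]) e1
      (((Nat.mul_le_mul_left n hnC).trans e2).trans e1) (e2.trans e1)
      (Y₁ := fun ω i l => ω (i, .inl l)) (Y₂ := fun ω i l => ω (i, .inr (.inl l)))
      (y := fun ω i => foldPacket b₁ b₂ κ fun j => ω (i, j)) (hP₁ κ) (hP₂ κ) (fun i => by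
        simp only [foldPacket_apply]
        exact VMem.sum fun a _ => VMem.sum fun t _ => VMem.smul_const (hP₃ κ i a t) _)
  choose x₁ x₂ Q hQ hx₁ hx₂ hdec using hκ
  let out : (Fin R₁ ⊕ Fin R₂) × ((Fin k × Fin N) × Fin n) →
      (Fin C × PacketIdx n N k → K) → K := fun o ω =>
    Sum.elim (fun j => b₁.repr (x₁ o.2.1.1 o.2.1.2 ω j) o.2.2)
      (fun j => b₁.repr (b₂.repr (x₂ o.2.1.1 ω j) o.2.1.2) o.2.2) o.1
  have hout : ∀ κ j a t, out (j, ((κ, a), t)) ∈ Q κ := by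
    rintro κ (j | j) a t
    · exact hx₁ κ a (b₁.coord t ∘ₗ LinearMap.proj j)
    · exact hx₂ κ (b₁.coord t ∘ₗ (b₂.coord a).restrictScalars K ∘ₗ LinearMap.proj j)
  have hcomp := Computes.iUnion fun κ : Fin k => (hQ κ).computes
    (κ := (Fin R₁ ⊕ Fin R₂) × (Fin N × Fin n)) (f := fun o => out (o.1, ((κ, o.2.1), o.2.2)))
    fun o => hout κ o.1 o.2.1 o.2.2
  obtain ⟨D, hcost, hD⟩ := (hcomp.mono (T' := Set.range out) le_rfl (by
    rintro _ ⟨⟨j, ⟨κ, a⟩, t⟩, rfl⟩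
    exact Set.mem_iUnion.mpr ⟨κ, (j, a, t), rfl⟩)).exists_program
  refine ⟨D, hcost.trans ?_, ?_⟩
  · simp only [Fintype.card_prod, Fintype.card_sum, Fintype.card_fin]
    exact decoder_cost_le hn1 hN1 hC1 hnC hNC (by omega) rfl
  intro ω ι _ hι T₁ T₂ T₃ X₁ X₂ p hT hT₁ hrow
  have h₁ : ∀ i l, ω (i, .inl l) = T₁ i l + ∑ e, T₃ i e * p e (.inl l) := fun i l => by
    have := congrFun (hrow i) (.inl l)
    simpa [sent₁, sent₂, Finset.sum_apply, Matrix.one_apply] using this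
  have h₂ : ∀ i l, ω (i, .inr (.inl l)) = T₂ i l + ∑ e, T₃ i e * p e (.inr (.inl l)) :=
    fun i l => by
      have := congrFun (hrow i) (.inr (.inl l))
      simpa [sent₁, sent₂, Finset.sum_apply, Matrix.one_apply] using this
  have hsent : ∀ κ, _ := fun κ => hdec κ ω ι hι T₁ T₂ T₃
    (fun e l => p e (.inl l)) (fun e l => p e (.inr (.inl l)))
    (fun e => foldPacket b₁ b₂ κ (p e) -
      ∑ l, p e (.inl l) • ∑ j, G₁ l j • ∑ a, X₁ j (κ, a) • b₂ a -
      ∑ l, p e (.inr (.inl l)) • G₂.mulVec (fun j => X₂ j κ) l)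
    (fun j => ∑ a, X₁ j (κ, a) • b₂ a) (fun j => X₂ j κ) hT hT₁
    h₁ h₂ (fun i => sum_smul_eq_of_headers (h₁ i) (h₂ i) (by
      rw [hrow i]
      simp only [map_add, map_sum, map_smul, foldPacket_sent₁, foldPacket_sent₂]))
  rintro ⟨j | j, ⟨κ, a⟩, t⟩
  · rw [hD]
    show b₁.repr (x₁ κ a ω j) t = b₁.repr (X₁ j (κ, a)) t
    rw [(hsent κ).1 a j]
    congr 2
    simp [Finsupp.finsetSum_apply, Finsupp.single_apply]
  · rw [hD]
    show b₁.repr (b₂.repr (x₂ κ ω j) a) t = b₁.repr (b₂.repr (X₂ j κ) a) t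
    rw [(hsent κ).2]

theorem mainTheorem2 :
    ∃ A d : ℕ,
      ∀ (K : Type u) [Field K] [Fintype K] (F : Type v) [Field F] [Algebra K F]
        (L : Type w) [Field L] [Algebra F L] (R₁ R₂ z k n N C : ℕ),
        n = R₁ + 2 * z → N = R₂ + 2 * z → C = R₁ + R₂ + 2 * z →
      ∀ (b₁ : Module.Basis (Fin n) K F) (b₂ : Module.Basis (Fin N) F L)
        (G₁ : Matrix (Fin n) (Fin R₁) F) (G₂ : Matrix (Fin N) (Fin R₂) L),
        IsGabidulinGenerator K G₁ → IsGabidulinGenerator F G₂ →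
      ∃ D : ArithProgram K (Fin C × PacketIdx n N k)
          ((Fin R₁ ⊕ Fin R₂) × ((Fin k × Fin N) × Fin n)),
        D.cost ≤ A * (k * n * N) * C ^ d ∧
        ∀ (V : Type x) [Finite V] (E : Type y) [Fintype E] (Net : Network V E) (s₁ s₂ r : V)
          (recv : Fin C ≃ {e : E // Net.head e = r}),
          R₁ + 2 * z ≤ Net.minCut {s₁} r →
          R₂ + 2 * z ≤ Net.minCut {s₂} r →
          Net.minCut {s₁, s₂} r = C →
          1 - 2 * (Fintype.card E : ℝ) / (Fintype.card K : ℝ) ≤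
            uniformProb {c : Network.Coeffs K E n N |
              ∀ (X₁ : Matrix (Fin R₁) (Fin k × Fin N) F) (X₂ : Matrix (Fin R₂) (Fin k) L)
                (Z : Finset E) (inj : E → PacketIdx n N k → K),
                Z.card ≤ z → (∀ e ∉ Z, inj e = 0) →
                ∀ o : (Fin R₁ ⊕ Fin R₂) × ((Fin k × Fin N) × Fin n),
                  D.eval (fun i => Net.received s₁ s₂ recv c (sent₁ b₁ G₁ X₁)
                      (sent₂ b₁ b₂ G₂ X₂) inj i.1 i.2) o =
                    Matrix.fromRows (unfoldMat b₁ X₁) (unfoldMat b₁ (unfoldMat b₂ X₂))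
                      o.1 o.2} := by
  refine ⟨40000000000, 19, ?_⟩
  intro K _ _ F _ _ L _ _ R₁ R₂ z k n N C hn hN hC b₁ b₂ G₁ G₂ hG₁ hG₂
  let _ : Algebra K L := ((algebraMap F L).comp (algebraMap K F)).toAlgebra
  have : IsScalarTower K F L := IsScalarTower.of_algebraMap_eq' rfl
  have : FiniteDimensional K F := Module.Finite.of_basis b₁
  have : FiniteDimensional F L := Module.Finite.of_basis b₂
  have : Finite F := Module.finite_of_finite K
  have hn1 : 1 ≤ n := by
    have : finrank K F = n := by simpa using finrank_eq_card_basis b₁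
    exact this ▸ finrank_pos
  have hN1 : 1 ≤ N := by
    have : finrank F L = N := by simpa using finrank_eq_card_basis b₂
    exact this ▸ finrank_pos
  obtain ⟨D, hcost, hdec⟩ := exists_channel_decoder.{u, v, w, y} (k := k) hn hN hC b₁ b₂ hG₁ hG₂
  refine ⟨D, hcost, ?_⟩
  intro V _ E _ Net s₁ s₂ r recv hs₁ hs₂ hs₁₂
  have hr₁ : s₁ ≠ r := by
    rintro rfl
    rw [Net.minCut_eq_zero (Set.mem_singleton _)] at hs₁
    omega
  have hr₂ : s₂ ≠ r := by
    rintro rfl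
    rw [Net.minCut_eq_zero (Set.mem_singleton _)] at hs₂
    omega
  -- First bad event: the rows of `[T₁ G₁ | T₂]` fail to span over `F`. The dimensions are `R₁` and
  -- `N`, with sum exactly `C`; sending all `n` dimensions of the first source would exceed the
  -- joint cut when `z > 0`.
  have hbad₁ := Net.ncard_span_ne_top_mul_card_le (K := K) (F := F) s₁ s₂ recv (fun l => G₁ l)
    (fun l => (Pi.single l (1 : F) : Fin N → F)) (span_rows_gabidulin hG₁ (by omega))
    (span_range_single N) hr₁ hr₂ (by simp; omega) (by simp; omega) (by simp; omega)
  -- Second bad event: the rows of `T₁` fail to span `K ^ n`. The second source is given the zero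
  -- space, so only the cut from `s₁` matters.
  have hbad₂ := Net.ncard_span_ne_top_mul_card_le (K := K) (F := K) (n := n) (N := N) s₁ s₂ recv
    (fun l => (Pi.single l (1 : K) : Fin n → K)) (fun _ => (0 : Fin 0 → K)) (span_range_single n)
    (Subsingleton.elim _ _) hr₁ hr₂ (by simp; omega) (by simp) (by simp; omega)
  rw [← Nat.card_eq_fintype_card (α := K)]
  refine uniformProb_ge Nat.card_pos hbad₁ hbad₂ fun c hc₁ hc₂ => ?_
  simp only [Set.mem_ofPred_eq, not_not] at hc₁ hc₂
  intro X₁ X₂ Z inj hZ hinj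
  set ω : Fin C × PacketIdx n N k → K := fun i => Net.received s₁ s₂ recv c (sent₁ b₁ G₁ X₁)
    (sent₂ b₁ b₂ G₂ X₂) inj i.1 i.2 with hω
  let T₁ : Fin C → Fin n → K := fun i l => Net.transfer s₁ s₂ c (recv i) (.inl (.inl l))
  let T₂ : Fin C → Fin N → K := fun i l => Net.transfer s₁ s₂ c (recv i) (.inl (.inr l))
  -- Errors are indexed by the attacked edges only, to have at most `z` of them; the decoder was
  -- fixed before this index type.
  let T₃ : Fin C → Z → K := fun i e => Net.transfer s₁ s₂ c (recv i) (.inr e)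
  have hrow : ∀ i, (fun j => ω (i, j)) = ∑ l, T₁ i l • (fun j => sent₁ b₁ G₁ X₁ l j) +
      ∑ l, T₂ i l • (fun j => sent₂ b₁ b₂ G₂ X₂ l j) + ∑ e, T₃ i e • inj e := by
    intro i
    have h := Net.received_row s₁ s₂ recv c (sent₁ b₁ G₁ X₁) (sent₂ b₁ b₂ G₂ X₂) inj i
    refine h.trans ?_
    congr 1
    rw [← Finset.sum_subset (Finset.subset_univ Z) fun e _ he => by rw [hinj e he, smul_zero]]
    exact (Finset.sum_coe_sort Z
      fun e => Net.transfer s₁ s₂ c (recv i) (.inr e) • inj e).symm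
  have hT₁ : span K (Set.range T₁) = ⊤ := by
    have h := congrArg (Submodule.map (LinearMap.fst K (Fin n → K) (Fin 0 → K))) hc₂
    rw [map_span, ← Set.range_comp, Submodule.map_top,
      LinearMap.range_eq_top.mpr LinearMap.fst_surjective] at h
    rw [← h]
    congr 2
    funext i l
    simp [T₁, Finset.sum_apply, Pi.single_apply]
  exact hdec ω Z (by simpa using hZ) T₁ T₂ T₃ X₁ X₂ (fun e => inj e) hc₁ hT₁ hrow

end Main
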